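/- Let $G$ be a locally compact, second countable, Hausdorff topological group with its Borel $\sigma$-algebra, acting measurably on standard Borel spaces $\mathbf X$ and $\mathbf Y$. Let $P_X$ be a probability measure on $\mathbf X$ and $P_{Y|X}$ a Markov kernel from $\mathbf X$ to $\mathbf Y$ that is $G$-equivariant: $P_{Y|X}(B\mid x)=P_{Y|X}(gB\mid gx)$ for all $g\in G$, $x\in\mathbf X$ and measurable $B$. Let $\rho:\mathbf X\to\mathbf X$ be an orbit selector ($\rho(x)\in Gx$ and $\rho(gx)=\rho(x)$ for all $g,x$), and let $Q$ be an inversion kernel for $\rho$: a family $Q(\cdot\mid x)$ of probability measures on $G$ with $Q(B\mid gx)=Q(g^{-1}B\mid x)$ for all $g,x,B$, and such that $\tilde\tau\rho(x)=x$ almost surely when $\tilde\tau\sim Q(\cdot\mid x)$. Both are assumed measurable with respect to the $P_X$-completion of the Borel $\sigma$-algebra of $\mathbf X$. For $X\sim P_X$, with $Y\sim P_{Y|X}(\cdot\mid X)$ and $\tilde\tau\sim Q(\cdot\mid X)$ conditionally independent given $X$, put $\tilde Y=\tilde\tau^{-1}Y$. Let $P_{\tilde Y|\rho}$ be the regular conditional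 distribution of $\tilde Y$ given $\rho(X)$, let $P_{X|\rho}$ be that of $X$ given $\rho(X)$, and let $P_{\Gamma|\rho}(\cdot\mid r)=\int Q(\cdot\mid x')\,P_{X|\rho}(dx'\mid r)$. Let $(X_i,Y_i)$, $i=1,\dots,n$, be i.i.d. with law $P_X\otimes P_{Y|X}$, and let $T:(\mathbf X\times\mathbf Y)^n\to\mathbb R$ be measurable. In R1 and R2 below, let $\tilde\tau_i\sim Q(\cdot\mid X_i)$ be sampled such that the triples $(X_i,Y_i,\tilde\tau_i)$ are i.i.d. and $\tilde\tau_i$ is conditionally independent of $Y_i$ given $X_i$; put $\tilde Y_i=\tilde\tau_i^{-1}Y_i$. Randomized samples $(X,Y)^{(b)}_{1:n}=\big(\Gamma_i^{(b)}\rho(X_i),\,\Gamma_i^{(b)}\tilde Y_i^{(b)}\big)_{i=1}^n$, $b=1,2,\dots$, are generated by one of the following procedures, where all draws are conditionally independent over $i$ and $b$ given the data (and given $\tilde\tau_{1:n}$ in R1 and R2): - R1: $S_i=(\rho(X_i),\tilde Y_i)$, $\tilde Y_i^{(b)}=\tilde Y_i$, and $\Gamma_i^{(b)}\sim P_{\Gamma|\rho}(\cdot\mid\rho(X_i))$.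 - R2: $S_i=(\rho(X_i),\tilde\tau_i)$, $\Gamma_i^{(b)}=\tilde\tau_i$, and $\tilde Y_i^{(b)}\sim P_{\tilde Y|\rho}(\cdot\mid\rho(X_i))$. - R3: $S_i=\rho(X_i)$, and $\Gamma_i^{(b)}\sim P_{\Gamma|\rho}(\cdot\mid\rho(X_i))$ and $\tilde Y_i^{(b)}\sim P_{\tilde Y|\rho}(\cdot\mid\rho(X_i))$ are drawn independently. Assume $\mathbb P\big(T((X,Y)^{(b)}_{1:n})=T((X,Y)^{(b')}_{1:n})\big)=0$ for all $b\ne b'$ in $\{1,2,\dots\}$. For $B\in\mathbb N$ let $$p_B=\frac{1+\sum_{b=1}^B\mathbf 1\{T((X,Y)^{(b)}_{1:n})\ge T((X,Y)_{1:n})\}}{B+1}.$$ Then for each of the three procedures: 1. For every $B\in\mathbb N$ and $\alpha\in[0,1]$, almost surely $$\mathbb P(p_B\le\alpha\mid S_{1:n})=\frac{\lfloor\alpha(B+1)\rfloor}{B+1}\le\alpha .$$ 2. For almost every value $s_{1:n}$ of $S_{1:n}$, conditionally on $S_{1:n}=s_{1:n}$, almost surely as $B\to\infty$, $$p_B\longrightarrow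 F_{s_{1:n}}\big(T((X,Y)_{1:n})\big),\qquad F_{s}(u)=\mathbb P\big(T((X,Y)_{1:n})\ge u\mid S_{1:n}=s\big).$$ That is, the limit is the conditional probability, given $S'_{1:n}=S_{1:n}=s_{1:n}$ and given the observed data, that $T((X',Y')_{1:n})\ge T((X,Y)_{1:n})$, where $((X',Y')_{1:n},S'_{1:n})$ is an independent copy of $((X,Y)_{1:n},S_{1:n})$. -/

import Mathlib

open MeasureTheory ProbabilityTheory Filter Topology
open scoped Pointwise

namespace CRT

section Symmetry

variable {G : Type*} [Group G] [MeasurableSpace G]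
variable {X : Type*} [MeasurableSpace X] [MulAction G X]
variable {Y : Type*} [MeasurableSpace Y] [MulAction G Y]

/-- The conditional distribution `P_{Y|X}` (a Markov kernel `κ`) is `G`-equivariant:
`P(B | x) = P(gB | gx)` for all `x`, all measurable `B` and all `g`. -/
def EquivariantKernel (G : Type*) [Group G] {X : Type*} [MeasurableSpace X] [MulAction G X]
    {Y : Type*} [MeasurableSpace Y] [MulAction G Y] (κ : Kernel X Y) : Prop :=
  ∀ (g : G) (x : X) (B : Set Y), MeasurableSet B → κ x B = κ (g • x) (g • B)

/-- `ρ` is an orbit selector: it picks one representative `ρ x ∈ O(x)` from each orbit, and it is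
measurable with respect to the `ν`-completion of the Borel `σ`-algebra. -/
structure IsOrbitSelector (G : Type*) [Group G] {X : Type*} [MeasurableSpace X] [MulAction G X]
    (ν : Measure X) (ρ : X → X) : Prop where
  aemeasurable : AEMeasurable ρ ν
  mem_orbit : ∀ x, ρ x ∈ MulAction.orbit G x
  invariant : ∀ (g : G) (x : X), ρ (g • x) = ρ x

/-- An inversion kernel for the orbit selector `ρ`: a family of probability measures on `G`,
measurable with respect to the `ν`-completion, which is `G`-equivariant,
`Q(B | gx) = Q(g⁻¹B | x)`, and such that `t ∼ Q(· | x)` satisfies `t • ρ x = x` almost surely.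
(At `x = ρ x` these two properties say that `Q(· | x)` is a left-invariant probability measure on
the stabilizer of `x`, that is, its normalized Haar measure.) -/
structure InversionKernel (G : Type*) [Group G] [MeasurableSpace G]
    {X : Type*} [MeasurableSpace X] [MulAction G X] (ν : Measure X) (ρ : X → X) where
  toFun : X → Measure G
  isProbabilityMeasure : ∀ x, IsProbabilityMeasure (toFun x)
  aemeasurable : AEMeasurable toFun ν
  equivariant : ∀ (g : G) (x : X) (B : Set G), MeasurableSet B →
    toFun (g • x) B = toFun x (g⁻¹ • B)
  inverts : ∀ x, ∀ᵐ t ∂(toFun x), t • ρ x = x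

/-- The joint law of `(X, Y, t)`, where `X ∼ PX`, `Y ∼ κ(· | X)` and `t ∼ Q(· | X)`, with `Y` and `t`
conditionally independent given `X`. -/
noncomputable def jointLaw {PX : Measure X} {ρ : X → X} (κ : Kernel X Y)
    (Q : InversionKernel G PX ρ) : Measure (X × Y × G) :=
  PX.bind fun x => (Measure.dirac x).prod ((κ x).prod (Q.toFun x))

instance instIsFiniteMeasureJointLaw {PX : Measure X} [IsProbabilityMeasure PX] {ρ : X → X}
    (κ : Kernel X Y) [IsMarkovKernel κ] (Q : InversionKernel G PX ρ) :
    IsFiniteMeasure (jointLaw κ Q) := by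
  constructor
  unfold jointLaw
  by_cases h : AEMeasurable
      (fun x => (Measure.dirac x).prod ((κ x).prod (Q.toFun x))) PX
  · rw [Measure.bind_apply MeasurableSet.univ h]
    have h1 : ∀ x, ((Measure.dirac x).prod ((κ x).prod (Q.toFun x))) Set.univ = 1 := by
      intro x
      have := Q.isProbabilityMeasure x
      exact measure_univ
    simp [h1]
  · rw [Measure.bind, Measure.map_of_not_aemeasurable h]
    simp

/-- The group-orbit kernel `P_{Γ|ρ}(· | r) = ∫ Q(· | x') P_{X|ρ}(dx' | r)`, where `P_{X|ρ}` is the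
regular conditional distribution of `X` given `ρ(X)`. -/
noncomputable def groupOrbitKernel [StandardBorelSpace X] [Nonempty X]
    {PX : Measure X} [IsProbabilityMeasure PX] {ρ : X → X} (Q : InversionKernel G PX ρ)
    (r : X) : Measure G :=
  (condDistrib id ρ PX r).bind Q.toFun

/-- `P_{Ỹ|ρ}`: the regular conditional distribution of `Ỹ = t⁻¹ • Y` given `ρ(X)`. -/
noncomputable def centeredKernel [StandardBorelSpace Y] [Nonempty Y]
    {PX : Measure X} [IsProbabilityMeasure PX] {ρ : X → X} (κ : Kernel X Y) [IsMarkovKernel κ]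
    (Q : InversionKernel G PX ρ) : Kernel X Y :=
  condDistrib (fun w : X × Y × G => w.2.2⁻¹ • w.2.1) (fun w => ρ w.1) (jointLaw κ Q)

end Symmetry

section Sampling

variable {Ω : Type*} [MeasurableSpace Ω]

/-- Conditionally on `D`, the variables `V b i` (`b ∈ ℕ`, `i ∈ Fin n`) are mutually independent,
and `V b i` has law `K D i`. -/
def IsCondSample (μ : Measure Ω) {𝒟 E : Type*} [MeasurableSpace 𝒟] [MeasurableSpace E] {n : ℕ}
    (D : Ω → 𝒟) (V : ℕ → Fin n → Ω → E) (K : 𝒟 → Fin n → Measure E) : Prop :=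
  ∀ (B : ℕ) (C : Set 𝒟) (A : ℕ → Fin n → Set E), MeasurableSet C →
    (∀ b i, MeasurableSet (A b i)) →
    μ {ω | D ω ∈ C ∧ ∀ b < B, ∀ i, V b i ω ∈ A b i} =
      ∫⁻ ω in {ω | D ω ∈ C}, ∏ b ∈ Finset.range B, ∏ i, K (D ω) i (A b i) ∂μ

variable {G : Type*} [Group G] [MeasurableSpace G]
variable {X : Type*} [MeasurableSpace X] [StandardBorelSpace X] [Nonempty X] [MulAction G X]
variable {Y : Type*} [MeasurableSpace Y] [StandardBorelSpace Y] [Nonempty Y] [MulAction G Y]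
variable {n : ℕ}

/-- The data `(Xᵢ, Yᵢ)` are i.i.d. with law `PX ⊗ κ`. -/
def IsIIDData (μ : Measure Ω) (PX : Measure X) (κ : Kernel X Y)
    (Xs : Fin n → Ω → X) (Ys : Fin n → Ω → Y) : Prop :=
  iIndepFun (fun i ω => (Xs i ω, Ys i ω)) μ ∧
    ∀ i, μ.map (fun ω => (Xs i ω, Ys i ω)) = PX ⊗ₘ κ

/-- The data `(Xᵢ, Yᵢ)` are i.i.d. with law `PX ⊗ κ`, and the `tᵢ` are sampled independently from
the inversion kernel, `tᵢ ∼ Q(· | Xᵢ)`. -/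
def IsIIDDataWithInversion (μ : Measure Ω) {PX : Measure X} {ρ : X → X} (κ : Kernel X Y)
    (Q : InversionKernel G PX ρ)
    (Xs : Fin n → Ω → X) (Ys : Fin n → Ω → Y) (t : Fin n → Ω → G) : Prop :=
  iIndepFun (fun i ω => (Xs i ω, Ys i ω, t i ω)) μ ∧
    ∀ i, μ.map (fun ω => (Xs i ω, Ys i ω, t i ω)) = jointLaw κ Q

/-- First procedure: `Ỹᵢ⁽ᵇ⁾ = Ỹᵢ = tᵢ⁻¹ • Yᵢ` is kept fixed, and `Γᵢ⁽ᵇ⁾ ∼ P_{Γ|ρ}(· | ρ(Xᵢ))`. -/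
def IsRandomizationR1 (μ : Measure Ω) {PX : Measure X} [IsProbabilityMeasure PX] {ρ : X → X}
    (κ : Kernel X Y) (Q : InversionKernel G PX ρ)
    (Xs : Fin n → Ω → X) (Ys : Fin n → Ω → Y) (t : Fin n → Ω → G)
    (Γ : ℕ → Fin n → Ω → G) (Yt : ℕ → Fin n → Ω → Y) : Prop :=
  IsIIDDataWithInversion μ κ Q Xs Ys t ∧
  (∀ b i ω, Yt b i ω = (t i ω)⁻¹ • Ys i ω) ∧
  IsCondSample μ (fun ω i => (Xs i ω, Ys i ω, t i ω)) Γ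
    (fun d i => groupOrbitKernel Q (ρ (d i).1))

/-- Second procedure: `Γᵢ⁽ᵇ⁾ = tᵢ` is kept fixed, and `Ỹᵢ⁽ᵇ⁾ ∼ P_{Ỹ|ρ}(· | ρ(Xᵢ))`. -/
def IsRandomizationR2 (μ : Measure Ω) {PX : Measure X} [IsProbabilityMeasure PX] {ρ : X → X}
    (κ : Kernel X Y) [IsMarkovKernel κ] (Q : InversionKernel G PX ρ)
    (Xs : Fin n → Ω → X) (Ys : Fin n → Ω → Y) (t : Fin n → Ω → G)
    (Γ : ℕ → Fin n → Ω → G) (Yt : ℕ → Fin n → Ω → Y) : Prop :=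
  IsIIDDataWithInversion μ κ Q Xs Ys t ∧
  (∀ b i ω, Γ b i ω = t i ω) ∧
  IsCondSample μ (fun ω i => (Xs i ω, Ys i ω, t i ω)) Yt
    (fun d i => centeredKernel κ Q (ρ (d i).1))

/-- Third procedure: `Γᵢ⁽ᵇ⁾ ∼ P_{Γ|ρ}(· | ρ(Xᵢ))` and `Ỹᵢ⁽ᵇ⁾ ∼ P_{Ỹ|ρ}(· | ρ(Xᵢ))`, independently. -/
def IsRandomizationR3 (μ : Measure Ω) {PX : Measure X} [IsProbabilityMeasure PX] {ρ : X → X}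
    (κ : Kernel X Y) [IsMarkovKernel κ] (Q : InversionKernel G PX ρ)
    (Xs : Fin n → Ω → X) (Ys : Fin n → Ω → Y)
    (Γ : ℕ → Fin n → Ω → G) (Yt : ℕ → Fin n → Ω → Y) : Prop :=
  IsIIDData μ PX κ Xs Ys ∧
  IsCondSample μ (fun ω i => (Xs i ω, Ys i ω)) (fun b i ω => (Γ b i ω, Yt b i ω))
    (fun d i => (groupOrbitKernel Q (ρ (d i).1)).prod (centeredKernel κ Q (ρ (d i).1)))

/-- The observed sample `(X, Y)_{1:n}`. -/
def observed (Xs : Fin n → Ω → X) (Ys : Fin n → Ω → Y) (ω : Ω) : Fin n → X × Y :=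
  fun i => (Xs i ω, Ys i ω)

/-- The randomized samples `(X, Y)ᵢ⁽ᵇ⁾ = (Γᵢ⁽ᵇ⁾ • ρ(Xᵢ), Γᵢ⁽ᵇ⁾ • Ỹᵢ⁽ᵇ⁾)`, as a sequence in `b`. -/
def randomized (ρ : X → X) (Xs : Fin n → Ω → X) (Γ : ℕ → Fin n → Ω → G)
    (Yt : ℕ → Fin n → Ω → Y) (ω : Ω) : ℕ → Fin n → X × Y :=
  fun b i => (Γ b i ω • ρ (Xs i ω), Γ b i ω • Yt b i ω)

/-- The randomization `p`-value
`p_B = (1 + #{b : T(z⁽ᵇ⁾) ≥ T(z)}) / (B + 1)` of a sample `z` and its first `B` randomizations. -/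
noncomputable def pValue {Z : Type*} (T : Z → ℝ) (z : Z) (zr : ℕ → Z) (B : ℕ) : ℝ :=
  (1 + ∑ b ∈ Finset.range B, {b' | T z ≤ T (zr b')}.indicator (fun _ => (1 : ℝ)) b) / (B + 1)

/-- Conditional level: for every `B` and `α ∈ [0, 1]`,
`P(p_B ≤ α | S) = ⌊α (B + 1)⌋ / (B + 1) ≤ α` almost surely. -/
def HasConditionalLevel (μ : Measure Ω) [IsFiniteMeasure μ] {Z 𝒮 : Type*} [MeasurableSpace 𝒮]
    (T : Z → ℝ) (z : Ω → Z) (zr : Ω → ℕ → Z) (S : Ω → 𝒮) : Prop :=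
  ∀ (B : ℕ) (α : ℝ), 0 ≤ α → α ≤ 1 →
    (∀ᵐ ω ∂μ, (condDistrib (fun ω' => pValue T (z ω') (zr ω') B) S μ (S ω)).real (Set.Iic α) =
      (⌊α * ((B : ℝ) + 1)⌋ : ℝ) / ((B : ℝ) + 1)) ∧
    (⌊α * ((B : ℝ) + 1)⌋ : ℝ) / ((B : ℝ) + 1) ≤ α

/-- Conditional strong consistency: for almost every value `s` of `S`, conditionally on `S = s`,
almost surely as `B → ∞` the `p`-value converges to the conditional probability given `S' = s` that
an independent copy `z'` of the sample satisfies `T z' ≥ T z`, with `z` the observed sample. -/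
def HasConditionalConsistency (μ : Measure Ω) [IsFiniteMeasure μ] {Z 𝒮 : Type*}
    [MeasurableSpace Z] [StandardBorelSpace Z] [Nonempty Z] [MeasurableSpace 𝒮]
    (T : Z → ℝ) (z : Ω → Z) (zr : Ω → ℕ → Z) (S : Ω → 𝒮) : Prop :=
  ∀ᵐ s ∂(μ.map S), ∀ᵐ w ∂(condDistrib (fun ω => (z ω, zr ω)) S μ s),
    Tendsto (fun B : ℕ => pValue T w.1 w.2 B) atTop
      (𝓝 ((condDistrib z S μ s).real {z' | T w.1 ≤ T z'}))

end Sampling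

end CRT

/-! Given `S`, the observed sample and its randomizations are i.i.d. from one law `M s`; the rest is
about i.i.d. sequences.

For a single observation, equivariance and `t • ρ x = x` show that, given `X = x` and `t`, the
variable `t⁻¹ • Y` has law `κ (ρ x)` (`map_centered_jointLaw`). This law depends on `x` only through
`ρ x` and not on `t`. Hence `t⁻¹ • Y` and `t` are conditionally independent given `ρ X`, with laws
`κ` and `P_{Γ|ρ}` (`map_selector_jointLaw`), and `P_{Ỹ|ρ} = κ` almost surely. Since `(X, Y) = (t • ρ
X, t • (t⁻¹ • Y))`, each procedure keeps the statistic and redraws the remaining component from its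
exact conditional law.

`map_randomized` carries this to `n` observations and infinitely many draws. `level_and_consistency`
then works fibrewise: the `p`-value is the rank of one among `B + 1` exchangeable scores without
ties (`prob_pValue_le`), and it converges by the strong law (`tendsto_pValue`).

Completion measurability of `ρ` and `Q` is handled throughout by passing to Borel versions that
agree almost everywhere. -/

namespace CRT

/-! ### Infinite products of Markov kernels. -/

section InfinitePiKernel

variable {ι A E : Type*} [MeasurableSpace A] [MeasurableSpace E]

/-- The kernel `a ↦ ⨂ i, k i a`. -/
noncomputable def infPi (k : ι → Kernel A E) [∀ i, IsMarkovKernel (k i)] : Kernel A (ι → E) where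
  toFun a := Measure.infinitePi fun i => k i a
  measurable' := by
    refine Measurable.measure_of_isPiSystem_of_isProbabilityMeasure
      (generateFrom_squareCylinders (α := fun _ : ι => E)).symm
      (isPiSystem_squareCylinders (fun _ => MeasurableSpace.isPiSystem_measurableSet)
        (fun _ => MeasurableSet.univ)) ?_
    rintro _ ⟨s, t, ht, rfl⟩
    have ht' : ∀ i, MeasurableSet (t i) := fun i => ht i (Set.mem_univ i)
    simp_rw [Measure.infinitePi_pi (s := s) _ (fun i _ => ht' i)]
    exact Finset.measurable_fun_prod _ fun i _ => (k i).measurable_coe (ht' i)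

lemma infPi_apply (k : ι → Kernel A E) [∀ i, IsMarkovKernel (k i)] (a : A) :
    infPi k a = Measure.infinitePi fun i => k i a := rfl

instance (k : ι → Kernel A E) [∀ i, IsMarkovKernel (k i)] : IsMarkovKernel (infPi k) :=
  ⟨fun a => by rw [infPi_apply]; infer_instance⟩

/-- A joint law is `ν ⊗ infPi k` as soon as both agree on products with square cylinders. -/
lemma eq_compProd_infPi {ν : Measure A} [IsFiniteMeasure ν] (k : ι → Kernel A E)
    [∀ i, IsMarkovKernel (k i)] (θ : Measure (A × (ι → E))) [IsFiniteMeasure θ]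
    (h : ∀ (C : Set A) (s : Finset ι) (t : ι → Set E), MeasurableSet C →
      (∀ i, MeasurableSet (t i)) →
      θ (C ×ˢ (s : Set ι).pi t) = ∫⁻ a in C, ∏ i ∈ s, k i a (t i) ∂ν) :
    θ = ν ⊗ₘ infPi k := by
  have key : ∀ (C : Set A) (s : Finset ι) (t : ι → Set E), MeasurableSet C →
      (∀ i, MeasurableSet (t i)) →
      θ (C ×ˢ (s : Set ι).pi t) = (ν ⊗ₘ infPi k) (C ×ˢ (s : Set ι).pi t) := by
    intro C s t hC ht
    rw [h C s t hC ht, Measure.compProd_apply_prod hC (.pi s.countable_toSet fun i _ => ht i)]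
    simp_rw [infPi_apply, Measure.infinitePi_pi (s := s) _ (fun i _ => ht i)]
  refine Measure.ext_prod fun {C F} hC hF => ?_
  -- With `C` fixed, both sides become finite measures in `F` alone, so agreement on the π-system of
  -- square cylinders suffices.
  have hres : ∀ (η : Measure (A × (ι → E))) {F : Set (ι → E)}, MeasurableSet F →
      η (C ×ˢ F) = (η.restrict (C ×ˢ Set.univ)).map Prod.snd F := by
    intro η F hF
    rw [Measure.map_apply measurable_snd hF, Measure.restrict_apply (measurable_snd hF)]
    congr 1
    ext ⟨a, e⟩
    simp [and_comm]
  rw [hres θ hF, hres _ hF]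
  congr 1
  refine ext_of_generate_finite _ (generateFrom_squareCylinders (α := fun _ : ι => E)).symm
      (isPiSystem_squareCylinders (fun _ => MeasurableSpace.isPiSystem_measurableSet)
        (fun _ => MeasurableSet.univ)) ?_ ?_
  · rintro _ ⟨s, t, ht, rfl⟩
    have ht' : ∀ i, MeasurableSet (t i) := fun i => ht i (Set.mem_univ i)
    have hm : MeasurableSet ((s : Set ι).pi t) := .pi s.countable_toSet fun i _ => ht' i
    rw [← hres θ hm, ← hres _ hm, key C s t hC ht']
  · rw [← hres θ .univ, ← hres _ .univ]
    simpa using key C ∅ (fun _ => Set.univ) hC (fun _ => .univ)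

end InfinitePiKernel

/-! ### Counting ranks among distinct reals. -/

section Rank

/-- Among `N` distinct values, exactly `k` have descending rank at most `k`. -/
lemma card_rank_le {N : ℕ} {f : ℕ → ℝ} (hf : Set.InjOn f (Finset.range N)) {k : ℕ} (hk : k ≤ N) :
    ((Finset.range N).filter fun j =>
      ((Finset.range N).filter fun i => f j ≤ f i).card ≤ k).card = k := by
  set R : ℕ → ℕ := fun j => ((Finset.range N).filter fun i => f j ≤ f i).card with hR
  have hlt : ∀ i ∈ Finset.range N, ∀ j ∈ Finset.range N, f i < f j → R j < R i := by
    intro i hi j hj hij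
    refine Finset.card_lt_card ⟨fun x hx => ?_, fun h => ?_⟩
    · simp only [Finset.mem_filter] at hx ⊢
      exact ⟨hx.1, hij.le.trans hx.2⟩
    · have := h (Finset.mem_filter.2 ⟨hi, le_rfl⟩)
      exact absurd (Finset.mem_filter.1 this).2 (not_le.2 hij)
  have hinj : Set.InjOn R (Finset.range N) := by
    intro i hi j hj hij
    rcases lt_trichotomy (f i) (f j) with h | h | h
    · exact absurd hij (hlt i hi j hj h).ne'
    · exact hf hi hj h
    · exact absurd hij (hlt j hj i hi h).ne
  -- Ranks lie in `{1, …, N}`, because each value is counted against itself, and they are distinct;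
  -- hence every rank occurs exactly once.
  have himg : (Finset.range N).image R = Finset.Icc 1 N := by
    refine Finset.eq_of_subset_of_card_le ?_ ?_
    · intro r hr
      obtain ⟨j, hj, rfl⟩ := Finset.mem_image.1 hr
      refine Finset.mem_Icc.2 ⟨Finset.card_pos.2 ⟨j, Finset.mem_filter.2 ⟨hj, le_rfl⟩⟩, ?_⟩
      simpa using Finset.card_filter_le (Finset.range N) fun i => f j ≤ f i
    · rw [Finset.card_image_of_injOn hinj]; simp
  have h1 : ((Finset.range N).filter fun j => R j ≤ k).image R = Finset.Icc 1 k := by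
    ext r
    simp only [Finset.mem_image, Finset.mem_filter, Finset.mem_Icc]
    constructor
    · rintro ⟨j, ⟨hj, hjk⟩, rfl⟩
      have : R j ∈ Finset.Icc 1 N := himg ▸ Finset.mem_image_of_mem R hj
      exact ⟨(Finset.mem_Icc.1 this).1, hjk⟩
    · rintro ⟨h1, h2⟩
      have : r ∈ (Finset.range N).image R := himg ▸ Finset.mem_Icc.2 ⟨h1, h2.trans hk⟩
      obtain ⟨j, hj, rfl⟩ := Finset.mem_image.1 this
      exact ⟨j, ⟨hj, h2⟩, rfl⟩
  rw [← Finset.card_image_of_injOn (hinj.mono fun x hx =>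
    (Finset.mem_coe.2 (Finset.mem_filter.1 (Finset.mem_coe.1 hx)).1)), h1]
  simp

end Rank

/-! ### The `p`-value for an i.i.d. sequence: uniformity and strong law. -/

section PValue

variable {Z : Type*}

/-- The sequence `z, w 0, w 1, …`. -/
def consSeq (p : Z × (ℕ → Z)) : ℕ → Z
  | 0 => p.1
  | b + 1 => p.2 b

/-- The `1 +` in the numerator is the term `i = 0`, in which the observed score is compared with
itself. -/
lemma pValue_eq_rank (T : Z → ℝ) (p : Z × (ℕ → Z)) (B : ℕ) :
    pValue T p.1 p.2 B =
      (((Finset.range (B + 1)).filter fun i =>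
        T (consSeq p 0) ≤ T (consSeq p i)).card : ℝ) / (B + 1) := by
  unfold pValue
  congr 1
  rw [Finset.card_filter, Finset.sum_range_succ', if_pos le_rfl, Nat.cast_add, Nat.cast_sum,
    Nat.cast_one, add_comm]
  congr 1
  refine Finset.sum_congr rfl fun x _ => ?_
  by_cases h : T (consSeq p 0) ≤ T (consSeq p (x + 1))
  · rw [if_pos h, Nat.cast_one]
    exact Set.indicator_of_mem (s := {b | T p.1 ≤ T (p.2 b)}) h fun _ => (1 : ℝ)
  · rw [if_neg h, Nat.cast_zero]
    exact Set.indicator_of_notMem (s := {b | T p.1 ≤ T (p.2 b)}) h fun _ => (1 : ℝ)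

variable [MeasurableSpace Z]

lemma measurable_consSeq : Measurable (consSeq (Z := Z)) := by
  refine measurable_pi_lambda _ fun b => ?_
  cases b with
  | zero => exact measurable_fst
  | succ b => exact (measurable_pi_apply b).comp measurable_snd

lemma measurable_pValue {T : Z → ℝ} (hT : Measurable T) (B : ℕ) :
    Measurable fun p : Z × (ℕ → Z) => pValue T p.1 p.2 B := by
  unfold pValue
  refine (measurable_const.add (Finset.measurable_fun_sum _ fun b _ => ?_)).div_const _
  have : MeasurableSet {p : Z × (ℕ → Z) | T p.1 ≤ T (p.2 b)} :=
    measurableSet_le (by fun_prop) (by fun_prop)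
  exact (measurable_const (a := (1 : ℝ))).indicator this

/-- This puts the observed sample at index `0` of a single i.i.d. sequence, where permutations of
the indices can move it. -/
lemma map_consSeq (m : Measure Z) [IsProbabilityMeasure m] :
    (m.prod (Measure.infinitePi fun _ : ℕ => m)).map consSeq =
      Measure.infinitePi fun _ : ℕ => m := by
  refine Measure.eq_infinitePi _ fun s t ht => ?_
  rw [Measure.map_apply measurable_consSeq (.pi s.countable_toSet fun i _ => ht i)]
  classical
  obtain ⟨N, hN⟩ := s.exists_nat_subset_range
  -- Padding with `univ` turns a cylinder over `s` into one over the initial segment `0, …, N`,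
  -- which the shift by one splits cleanly.
  let t' : ℕ → Set Z := fun i => if i ∈ s then t i else Set.univ
  have ht' : ∀ i, MeasurableSet (t' i) := fun i => by
    simp only [t']; split_ifs; exacts [ht i, .univ]
  have h1 : consSeq ⁻¹' ((s : Set ℕ).pi t) =
      t' 0 ×ˢ (Set.pi (Finset.range N : Set ℕ) fun i => t' (i + 1)) := by
    ext ⟨z, w⟩
    simp only [Set.mem_preimage, Set.mem_pi, Set.mem_prod, Finset.mem_coe, Finset.mem_range, t']
    constructor
    · intro h
      refine ⟨?_, fun i _ => ?_⟩
      · split_ifs with h0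
        exacts [h 0 h0, trivial]
      · split_ifs with h0
        exacts [h _ h0, trivial]
    · rintro ⟨h0, h1⟩ i hi
      cases i with
      | zero => rwa [if_pos hi] at h0
      | succ i =>
        have := h1 i (by have := Finset.mem_range.1 (hN hi); omega)
        rwa [if_pos hi] at this
  rw [h1, Measure.prod_prod, Measure.infinitePi_pi _ fun i _ => ht' _, mul_comm,
    ← Finset.prod_range_succ' (fun i => m (t' i))]
  rw [← Finset.prod_subset (s₁ := s) (f := fun i => m (t' i))]
  · exact Finset.prod_congr rfl fun i hi => by simp [t', hi]
  · exact hN.trans (Finset.range_mono (Nat.le_succ N))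
  · intro i _ hi
    simp [t', hi]

lemma infinitePi_map_two (m : Measure Z) [IsProbabilityMeasure m] {i j : ℕ} (hij : i ≠ j) :
    (Measure.infinitePi fun _ : ℕ => m).map (fun w => (w i, w j)) = m.prod m := by
  have h := (iIndepFun_infinitePi (P := fun _ : ℕ => m) (X := fun _ z => z)
    (fun _ => measurable_id)).indepFun hij
  rw [indepFun_iff_map_prod_eq_prod_map_map (measurable_pi_apply i).aemeasurable
    (measurable_pi_apply j).aemeasurable] at h
  rw [h, Measure.infinitePi_map_eval, Measure.infinitePi_map_eval]

/-- For exchangeable scores without ties the randomization `p`-value is uniform on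
`{1 / (B + 1), …, 1}`. -/
lemma prob_pValue_le {T : Z → ℝ} (hT : Measurable T) (m : Measure Z) [IsProbabilityMeasure m]
    (hm : (m.prod m) {p | T p.1 = T p.2} = 0) (B : ℕ) {α : ℝ} (h0 : 0 ≤ α) (h1 : α ≤ 1) :
    (m.prod (Measure.infinitePi fun _ : ℕ => m)).real {p | pValue T p.1 p.2 B ≤ α} =
      (⌊α * ((B : ℝ) + 1)⌋ : ℝ) / ((B : ℝ) + 1) := by
  classical
  set P := Measure.infinitePi fun _ : ℕ => m with hP
  set k := ⌊α * ((B : ℝ) + 1)⌋₊ with hk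
  have hB : (0 : ℝ) < (B : ℝ) + 1 := by positivity
  have hkle : k ≤ B + 1 := by
    refine Nat.floor_le_of_le ?_
    push_cast
    nlinarith
  let R : ℕ → (ℕ → Z) → ℕ := fun j w =>
    ((Finset.range (B + 1)).filter fun i => T (w j) ≤ T (w i)).card
  have hRm : ∀ j, Measurable (R j) := by
    intro j
    simp only [R, Finset.card_filter]
    refine Finset.measurable_fun_sum _ fun i _ => ?_
    exact Measurable.ite (measurableSet_le (by fun_prop) (by fun_prop)) measurable_const
      measurable_const
  have hset : ∀ j, MeasurableSet {w | R j w ≤ k} := fun j => hRm j measurableSet_Iic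
  -- Ranks are integers, so the bound `α * (B + 1)` may be replaced by its floor `k`.
  have e1 : {p : Z × (ℕ → Z) | pValue T p.1 p.2 B ≤ α} = consSeq ⁻¹' {w | R 0 w ≤ k} := by
    ext p
    rw [Set.mem_ofPred_eq, pValue_eq_rank, div_le_iff₀ hB]
    exact (Nat.le_floor_iff (by positivity)).symm
  -- Exchangeability: transposing the coordinates `0` and `j` preserves `P` and carries one rank to
  -- the other.
  have hex : ∀ j ∈ Finset.range (B + 1), P.real {w | R j w ≤ k} = P.real {w | R 0 w ≤ k} := by
    intro j hj
    have hmap := Measure.map_infinitePi_infinitePi_of_inj (P := fun _ : ℕ => m)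
      (Equiv.swap 0 j).injective
    have : {w | R j w ≤ k} = (fun w : ℕ → Z => fun i => w (Equiv.swap 0 j i)) ⁻¹'
        {w | R 0 w ≤ k} := by
      ext w
      simp only [Set.mem_preimage, Set.mem_ofPred_eq, R, Equiv.swap_apply_left]
      have : ((Finset.range (B + 1)).filter fun i => T (w j) ≤ T (w i)).card =
          ((Finset.range (B + 1)).filter fun i => T (w j) ≤ T (w (Equiv.swap 0 j i))).card := by
        have hr : ∀ i ∈ Finset.range (B + 1), Equiv.swap 0 j i ∈ Finset.range (B + 1) := by
          intro i hi
          by_cases h0 : i = 0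
          · simpa [h0] using hj
          by_cases h1 : i = j
          · simp [h1]
          · rwa [Equiv.swap_apply_of_ne_of_ne h0 h1]
        refine Finset.card_bij (fun i _ => Equiv.swap 0 j i) ?_ ?_ ?_
        · intro i hi
          rw [Finset.mem_filter] at hi ⊢
          exact ⟨hr i hi.1, by simpa using hi.2⟩
        · intro a _ b _ h
          exact (Equiv.swap 0 j).injective h
        · intro b hb
          rw [Finset.mem_filter] at hb
          exact ⟨Equiv.swap 0 j b, Finset.mem_filter.2 ⟨hr b hb.1, hb.2⟩, by simp⟩
      rw [this]
    rw [this, ← map_measureReal_apply (by fun_prop) (hset 0)]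
    congr 1
  have hties : ∀ᵐ w ∂P, ∀ i j : ℕ, i ≠ j → T (w i) ≠ T (w j) := by
    rw [ae_all_iff]; intro i
    rw [ae_all_iff]; intro j
    by_cases hij : i = j
    · simp [hij]
    have hmt : MeasurableSet {p : Z × Z | T p.1 = T p.2} :=
      measurableSet_eq_fun (by fun_prop) (by fun_prop)
    rw [← infinitePi_map_two m hij, Measure.map_apply (by fun_prop) hmt] at hm
    filter_upwards [measure_eq_zero_iff_ae_notMem.1 hm] with w hw _
    exact hw
  -- The expectation of the identity in `card_rank_le`. By `hex` the `B + 1` summands are equal, so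
  -- each is `k / (B + 1)`.
  have hsum : ∑ j ∈ Finset.range (B + 1), P.real {w | R j w ≤ k} = k := by
    have : ∀ j, P.real {w | R j w ≤ k} = ∫ w, {w | R j w ≤ k}.indicator (fun _ => (1 : ℝ)) w ∂P :=
      fun j => by rw [integral_indicator (hset j)]; simp
    simp_rw [this]
    rw [← integral_finsetSum _ fun j _ => (integrable_const (1 : ℝ)).indicator (hset j)]
    have hc : ∀ᵐ w ∂P, ∑ j ∈ Finset.range (B + 1),
        {w | R j w ≤ k}.indicator (fun _ => (1 : ℝ)) w = k := by
      filter_upwards [hties] with w hw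
      have hinj : Set.InjOn (fun i => T (w i)) (Finset.range (B + 1)) := by
        intro i _ j _ hij
        by_contra hne
        exact hw i j hne hij
      have := card_rank_le hinj hkle
      rw [Finset.card_filter] at this
      have h2 := congrArg (Nat.cast (R := ℝ)) this
      push_cast at h2
      rw [← h2]
      refine Finset.sum_congr rfl fun j _ => ?_
      simp [Set.indicator_apply, R]
    rw [integral_congr_ae hc]
    simp
  rw [Finset.sum_congr rfl hex] at hsum
  simp only [Finset.sum_const, Finset.card_range, nsmul_eq_mul] at hsum
  push_cast at hsum
  rw [e1, ← map_measureReal_apply measurable_consSeq (hset 0), map_consSeq, eq_div_iff hB.ne',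
    ← natCast_floor_eq_intCast_floor (by positivity), ← hk, ← hsum, mul_comm]

/-- Strong law of large numbers for the randomization `p`-value. -/
lemma tendsto_pValue {T : Z → ℝ} (hT : Measurable T) (m : Measure Z) [IsProbabilityMeasure m] :
    ∀ᵐ p ∂(m.prod (Measure.infinitePi fun _ : ℕ => m)),
      Tendsto (fun B : ℕ => pValue T p.1 p.2 B) atTop (𝓝 (m.real {z' | T p.1 ≤ T z'})) := by
  have hset : ∀ z, MeasurableSet {z' | T z ≤ T z'} := fun z =>
    measurableSet_le measurable_const hT
  have hlim : Measurable fun z : Z => m.real {z' | T z ≤ T z'} := by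
    have h2 : MeasurableSet {p : Z × Z | T p.1 ≤ T p.2} :=
      measurableSet_le (by fun_prop) (by fun_prop)
    exact (measurable_measure_prodMk_left (ν := m) h2).ennreal_toReal
  have hmeas : MeasurableSet {p : Z × (ℕ → Z) | Tendsto (fun B : ℕ => pValue T p.1 p.2 B) atTop
      (𝓝 (m.real {z' | T p.1 ≤ T z'}))} :=
    measurableSet_tendsto_fun (fun B => measurable_pValue hT B) (hlim.comp measurable_fst)
  -- By Fubini the observed `z` may be frozen; the indicators of `T z ≤ T (w b)` are then i.i.d. and
  -- bounded.
  rw [Measure.ae_prod_iff_ae_ae hmeas]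
  refine ae_of_all _ fun z => ?_
  let f : Z → ℝ := {z' | T z ≤ T z'}.indicator fun _ => (1 : ℝ)
  have hf : Measurable f := measurable_const.indicator (hset z)
  have hint : ∫ w, f (w 0) ∂(Measure.infinitePi fun _ : ℕ => m) = m.real {z' | T z ≤ T z'} := by
    have h3 := integral_map (μ := Measure.infinitePi fun _ : ℕ => m) (φ := fun w : ℕ → Z => w 0)
      (measurable_pi_apply 0).aemeasurable (f := f) hf.aestronglyMeasurable
    rw [← h3, Measure.infinitePi_map_eval, integral_indicator (hset z)]
    simp
  have hfm : ∀ j : ℕ, Measurable fun w : ℕ → Z => f (w j) := fun j =>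
    hf.comp (measurable_pi_apply j)
  have hi := iIndepFun_infinitePi (P := fun _ : ℕ => m) (X := fun _ => f) (fun _ => hf)
  have hsl := strong_law_ae_real (μ := Measure.infinitePi fun _ : ℕ => m)
    (fun b (w : ℕ → Z) => f (w b)) ?_ (fun i j hij => hi.indepFun hij) ?_
  · filter_upwards [hsl] with w hw
    rw [hint] at hw
    have h1 : Tendsto (fun B : ℕ => (1 : ℝ) / ((B : ℝ) + 1)) atTop (𝓝 0) :=
      tendsto_one_div_add_atTop_nhds_zero_nat
    have h2 : Tendsto (fun B : ℕ => (B : ℝ) / ((B : ℝ) + 1)) atTop (𝓝 1) :=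
      tendsto_natCast_div_add_atTop (1 : ℝ)
    have h3 := h1.add (hw.mul h2)
    rw [zero_add, mul_one] at h3
    refine h3.congr fun B => ?_
    unfold pValue
    rw [add_div]
    congr 1
    have hs : ∑ b ∈ Finset.range B, {b' | T z ≤ T (w b')}.indicator (fun _ => (1 : ℝ)) b =
        ∑ b ∈ Finset.range B, f (w b) := rfl
    rw [hs]
    -- Cancelling `B` in `(∑ / B) * (B / (B + 1))` needs `B ≠ 0`; at `B = 0` both sides vanish.
    rcases Nat.eq_zero_or_pos B with rfl | hB
    · simp
    · have : (B : ℝ) ≠ 0 := by positivity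
      field_simp
  · refine Integrable.of_bound (hfm 0).aestronglyMeasurable 1 (ae_of_all _ fun w => ?_)
    simp only [f, Set.indicator_apply]
    split_ifs <;> simp
  · intro i
    refine ⟨(hfm i).aemeasurable, (hfm 0).aemeasurable, ?_⟩
    have : ∀ j : ℕ, (Measure.infinitePi fun _ : ℕ => m).map (fun w => f (w j)) = m.map f := by
      intro j
      have h := congrArg (Measure.map f) (Measure.infinitePi_map_eval (fun _ : ℕ => m) j)
      rwa [Measure.map_map hf (measurable_pi_apply j)] at h
    rw [this, this]

end PValue

/-! ### From conditionally i.i.d. samples to level and consistency. -/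

section Conditional

variable {Ω Z 𝒮 : Type*} [MeasurableSpace Ω] [MeasurableSpace Z] [StandardBorelSpace Z] [Nonempty Z]
  [MeasurableSpace 𝒮]

/-- By uniqueness of disintegrations, `hlaw` identifies the conditional law of `(z, zr)` at almost
every `s` as `M s` times its infinite power, which reduces both claims to the i.i.d. case.
Disintegrating `hties` for the pair `0, 1` gives a tie-free `M s × M s`, which also excludes ties
with the observed score. -/
lemma level_and_consistency (μ : Measure Ω) [IsProbabilityMeasure μ] {T : Z → ℝ}
    (hT : Measurable T) {z : Ω → Z} {zr : Ω → ℕ → Z} {S : Ω → 𝒮} (hz : AEMeasurable z μ)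
    (hzr : AEMeasurable zr μ) (hS : AEMeasurable S μ) (M : Kernel 𝒮 Z) [IsMarkovKernel M]
    (hlaw : μ.map (fun ω => (S ω, z ω, zr ω)) = μ.map S ⊗ₘ (M ×ₖ infPi fun _ : ℕ => M))
    (hties : μ {ω | T (zr ω 0) = T (zr ω 1)} = 0) :
    HasConditionalLevel μ T z zr S ∧ HasConditionalConsistency μ T z zr S := by
  have hzz : AEMeasurable (fun ω => (z ω, zr ω)) μ := hz.prodMk hzr
  have hS' : IsProbabilityMeasure (μ.map S) := Measure.isProbabilityMeasure_map hS
  have hK : condDistrib (fun ω => (z ω, zr ω)) S μ =ᵐ[μ.map S] M ×ₖ infPi fun _ : ℕ => M :=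
    condDistrib_ae_eq_of_measure_eq_compProd S hzz hlaw
  have hno : ∀ᵐ s ∂(μ.map S), ((M s).prod (M s)) {p | T p.1 = T p.2} = 0 := by
    have hmt : MeasurableSet {p : 𝒮 × Z × (ℕ → Z) | T (p.2.2 0) = T (p.2.2 1)} :=
      measurableSet_eq_fun (by fun_prop) (by fun_prop)
    have hmt2 : MeasurableSet {p : Z × Z | T p.1 = T p.2} :=
      measurableSet_eq_fun (by fun_prop) (by fun_prop)
    have h1 : (μ.map (fun ω => (S ω, z ω, zr ω)))
        {p : 𝒮 × Z × (ℕ → Z) | T (p.2.2 0) = T (p.2.2 1)} = 0 := by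
      rw [Measure.map_apply_of_aemeasurable (hS.prodMk hzz) hmt]
      exact hties
    rw [hlaw] at h1
    filter_upwards [Measure.ae_ae_of_ae_compProd (measure_eq_zero_iff_ae_notMem.1 h1)] with s hs
    rw [Kernel.prod_apply, infPi_apply] at hs
    rw [← infinitePi_map_two (M s) zero_ne_one, Measure.map_apply (by fun_prop) hmt2,
      measure_eq_zero_iff_ae_notMem]
    have hsnd : (((M s).prod (Measure.infinitePi fun _ : ℕ => M s)).map Prod.snd) =
      Measure.infinitePi fun _ : ℕ => M s := by simp
    rw [← hsnd]
    have hmt3 : MeasurableSet {w : ℕ → Z | T (w 0) = T (w 1)} :=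
      measurableSet_eq_fun (by fun_prop) (by fun_prop)
    exact (ae_map_iff measurable_snd.aemeasurable hmt3.compl).2 hs
  refine ⟨fun B α h0 h1 => ⟨?_, ?_⟩, ?_⟩
  · have hc := condDistrib_comp (mβ := ‹MeasurableSpace 𝒮›) S hzz (measurable_pValue hT B)
    refine ae_of_ae_map hS (p := fun s => (condDistrib
      (fun ω' => pValue T (z ω') (zr ω') B) S μ s).real (Set.Iic α) = _) ?_
    filter_upwards [hc, hK, hno] with s hs1 hs2 hs3
    change (condDistrib ((fun p : Z × (ℕ → Z) => pValue T p.1 p.2 B) ∘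
      fun ω => (z ω, zr ω)) S μ s).real (Set.Iic α) = _
    rw [hs1, Kernel.map_apply _ (measurable_pValue hT B), hs2, Kernel.prod_apply, infPi_apply,
      map_measureReal_apply (measurable_pValue hT B) measurableSet_Iic]
    exact prob_pValue_le hT (M s) hs3 B h0 h1
  · rw [div_le_iff₀ (by positivity)]
    exact Int.floor_le _
  · have hc := condDistrib_comp (mβ := ‹MeasurableSpace 𝒮›) S hzz measurable_fst
    unfold HasConditionalConsistency
    filter_upwards [hc, hK] with s hs1 hs2
    have : condDistrib z S μ s = M s := by
      change condDistrib (Prod.fst ∘ fun ω => (z ω, zr ω)) S μ s = _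
      rw [hs1, Kernel.map_apply _ measurable_fst, hs2, Kernel.prod_apply]
      simp
    rw [hs2, this, Kernel.prod_apply, infPi_apply]
    exact tendsto_pValue hT (M s)

end Conditional

/-! ### Pushforwards and finite products of disintegrations. -/

section Product

lemma map_compProd_of_fiber {A B C : Type*} [MeasurableSpace A] [MeasurableSpace B]
    [MeasurableSpace C] (ν : Measure A) [SFinite ν] (η : Kernel A B) [IsSFiniteKernel η]
    (η' : Kernel A C) [IsSFiniteKernel η'] {Ψ : A × B → C} (hΨ : Measurable Ψ)
    (h : ∀ᵐ a ∂ν, (η a).map (fun b => Ψ (a, b)) = η' a) :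
    (ν ⊗ₘ η).map (fun p => (p.1, Ψ p)) = ν ⊗ₘ η' := by
  ext F hF
  have hm : Measurable fun p : A × B => (p.1, Ψ p) := measurable_fst.prodMk hΨ
  rw [Measure.map_apply hm hF, Measure.compProd_apply (hm hF), Measure.compProd_apply hF]
  refine lintegral_congr_ae ?_
  filter_upwards [h] with a ha
  have hΨa : Measurable fun b => Ψ (a, b) := hΨ.comp measurable_prodMk_left
  rw [← ha, Measure.map_apply hΨa (measurable_prodMk_left hF)]
  rfl

/-- New randomness whose law depends on the data only through `S` is conditionally independent of
`z` given `S`. This is how the randomizations become independent of the observed sample in each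
fibre. -/
lemma map_compProd_comap {A B C W : Type*} [MeasurableSpace A] [MeasurableSpace B]
    [MeasurableSpace C] [MeasurableSpace W] (ν : Measure A) [IsFiniteMeasure ν] {S : A → B}
    (hS : Measurable S) {z : A → C} (hz : Measurable z) (M : Kernel B C) [IsMarkovKernel M]
    (N : Kernel B W) [IsMarkovKernel N] (h : ν.map (fun a => (S a, z a)) = ν.map S ⊗ₘ M) :
    (ν ⊗ₘ (N.comap S hS)).map (fun p => (S p.1, z p.1, p.2)) = ν.map S ⊗ₘ (M ×ₖ N) := by
  ext F hF
  have hm : Measurable fun p : A × W => (S p.1, z p.1, p.2) := by fun_prop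
  rw [Measure.map_apply hm hF, Measure.compProd_apply (hm hF), Measure.compProd_apply hF]
  have hG : Measurable fun q : (B × C) => N q.1 {w | (q.1, q.2, w) ∈ F} := by
    have := Kernel.measurable_kernel_prodMk_left (κ := N.comap (Prod.fst : B × C → B) measurable_fst)
      (t := {q : (B × C) × W | (q.1.1, q.1.2, q.2) ∈ F})
      ((show Measurable fun q : (B × C) × W => (q.1.1, q.1.2, q.2) by fun_prop) hF)
    exact this
  have e1 : ∫⁻ a, N (S a) {w | (S a, z a, w) ∈ F} ∂ν =
      ∫⁻ q, N q.1 {w | (q.1, q.2, w) ∈ F} ∂(ν.map (fun a => (S a, z a))) := by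
    rw [lintegral_map hG (hS.prodMk hz)]
  refine Eq.trans e1 ?_
  rw [h, Measure.lintegral_compProd hG]
  refine lintegral_congr fun s => ?_
  rw [Kernel.prod_apply, Measure.prod_apply (measurable_prodMk_left hF)]
  rfl

variable {ι A E : Type*} [Fintype ι] [MeasurableSpace A] [MeasurableSpace E]

/-- On boxes the integral of a product of functions of separate coordinates factors by independence,
so disintegration commutes with finite products. -/
lemma pi_compProd (β : Measure A) [IsProbabilityMeasure β] (L : Kernel A E) [IsMarkovKernel L] :
    (Measure.pi fun _ : ι => β ⊗ₘ L).map (fun p => (fun i => (p i).1, fun i => (p i).2)) =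
      (Measure.pi fun _ : ι => β) ⊗ₘ
        infPi (fun i : ι => L.comap (fun s : ι → A => s i) (measurable_pi_apply i)) := by
  set M := infPi (fun i : ι => L.comap (fun s : ι → A => s i) (measurable_pi_apply i))
  let e : (ι → A) × (ι → E) → ι → A × E := fun q i => (q.1 i, q.2 i)
  have he : Measurable e := by fun_prop
  have key : (Measure.pi fun _ : ι => β ⊗ₘ L) = ((Measure.pi fun _ : ι => β) ⊗ₘ M).map e := by
    refine Measure.pi_eq_generateFrom
      (C := fun _ => Set.image2 (· ×ˢ ·) {s | MeasurableSet s} {t | MeasurableSet t})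
      (fun _ => generateFrom_prod) (fun _ => isPiSystem_prod) (fun _ => ?_) ?_
    · exact ⟨fun _ => Set.univ, fun _ => ⟨Set.univ, .univ, Set.univ, .univ, by simp⟩,
        fun _ => measure_lt_top _ _, by simp [Set.iUnion_const]⟩
    · intro r hr
      choose C hC F hF hr using hr
      have hr' : ∀ i, r i = C i ×ˢ F i := fun i => (hr i).symm
      have hmr : ∀ i, MeasurableSet (r i) := fun i => hr' i ▸ (hC i).prod (hF i)
      have hpre : e ⁻¹' (Set.pi Set.univ r) = (Set.pi Set.univ C) ×ˢ (Set.pi Set.univ F) := by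
        ext ⟨a, b⟩
        simp [e, hr', Set.mem_pi, forall_and]
      have hmeas : ∀ i, Measurable ((C i).indicator fun a => L a (F i)) := fun i =>
        (L.measurable_coe (hF i)).indicator (hC i)
      rw [Measure.map_apply he (.univ_pi hmr), hpre,
        Measure.compProd_apply_prod (.univ_pi hC) (.univ_pi hF),
        ← lintegral_indicator (.univ_pi hC)]
      have e1 : ∀ a : ι → A, (Set.pi Set.univ C).indicator (fun a => M a (Set.pi Set.univ F)) a =
          ∏ i, (C i).indicator (fun a => L a (F i)) (a i) := by
        intro a
        have hMa : M a (Set.pi Set.univ F) = ∏ i, L (a i) (F i) := by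
          simp only [M, infPi_apply]
          rw [Measure.infinitePi_eq_pi, Measure.pi_pi]
          rfl
        by_cases ha : a ∈ Set.pi Set.univ C
        · rw [Set.indicator_of_mem ha, hMa]
          exact Finset.prod_congr rfl fun i _ =>
            (Set.indicator_of_mem (ha i (Set.mem_univ i)) fun a => L a (F i)).symm
        · rw [Set.indicator_of_notMem ha]
          obtain ⟨i, hi⟩ : ∃ i, a i ∉ C i := by simpa [Set.mem_pi] using ha
          exact (Finset.prod_eq_zero (Finset.mem_univ i) (Set.indicator_of_notMem hi _)).symm
      have hi := iIndepFun_pi (μ := fun _ : ι => β)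
        (X := fun i => (C i).indicator fun a => L a (F i)) fun i => (hmeas i).aemeasurable
      simp_rw [e1]
      rw [lintegral_prod_eq_prod_lintegral_of_indepFun Finset.univ _ hi
        fun i => (hmeas i).comp (measurable_pi_apply i)]
      refine Finset.prod_congr rfl fun i _ => ?_
      rw [hr' i, Measure.compProd_apply_prod (hC i) (hF i), ← lintegral_indicator (hC i)]
      have := lintegral_map (μ := Measure.pi fun _ : ι => β) (hmeas i) (measurable_pi_apply i)
      rw [← this]
      congr 1
      have := (measurePreserving_eval (fun _ : ι => β) i).map_eq
      exact this
  rw [key, Measure.map_map (by fun_prop) he]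
  exact Measure.map_id

end Product

/-! ### The joint law of data and randomizations. -/

section Sampling

variable {Ω 𝒟 𝒮 E Z : Type*} [MeasurableSpace Ω] [MeasurableSpace 𝒟] [MeasurableSpace 𝒮]
  [MeasurableSpace E] [MeasurableSpace Z] {n : ℕ}

/-- The law of `φ (s, e)` with `e ∼ k s`. -/
noncomputable def pushKernel (k : Kernel 𝒮 E) (φ : 𝒮 × E → Z) : Kernel 𝒮 Z :=
  (Kernel.id ×ₖ k).map φ

lemma pushKernel_apply (k : Kernel 𝒮 E) [IsMarkovKernel k] {φ : 𝒮 × E → Z} (hφ : Measurable φ)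
    (s : 𝒮) : pushKernel k φ s = (k s).map fun e => φ (s, e) := by
  rw [pushKernel, Kernel.map_apply _ hφ, Kernel.prod_apply, Kernel.id_apply, Measure.dirac_prod,
    Measure.map_map hφ measurable_prodMk_left]
  rfl

lemma isMarkovKernel_pushKernel (k : Kernel 𝒮 E) [IsMarkovKernel k] {φ : 𝒮 × E → Z}
    (hφ : Measurable φ) : IsMarkovKernel (pushKernel k φ) :=
  Kernel.IsMarkovKernel.map _ hφ

/-- `IsCondSample` only speaks of full blocks `b < B`. A general finite cylinder is such a block
padded with `univ`, and the padded factors have mass one. -/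
lemma map_condSample (μ : Measure Ω) [IsProbabilityMeasure μ] {D : Ω → 𝒟} (hD : Measurable D)
    {V : ℕ → Fin n → Ω → E} (hV : ∀ b i, Measurable (V b i)) {K : 𝒟 → Fin n → Measure E}
    (hS : IsCondSample μ D V K) (k : Fin n → Kernel 𝒟 E) [∀ i, IsMarkovKernel (k i)]
    (hK : ∀ i, ∀ᵐ ω ∂μ, K (D ω) i = k i (D ω)) :
    μ.map (fun ω => (D ω, fun p : ℕ × Fin n => V p.1 p.2 ω)) =
      μ.map D ⊗ₘ infPi fun p : ℕ × Fin n => k p.2 := by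
  classical
  have hm : Measurable fun ω => (D ω, fun p : ℕ × Fin n => V p.1 p.2 ω) :=
    hD.prodMk (measurable_pi_lambda _ fun p => hV p.1 p.2)
  have := Measure.isProbabilityMeasure_map (μ := μ) hm.aemeasurable
  have := Measure.isProbabilityMeasure_map (μ := μ) hD.aemeasurable
  refine eq_compProd_infPi _ _ fun C s t hC ht => ?_
  obtain ⟨B, hB⟩ := (s.image Prod.fst).exists_nat_subset_range
  have hB' : ∀ p ∈ s, p.1 < B := fun p hp =>
    Finset.mem_range.1 (hB (Finset.mem_image_of_mem Prod.fst hp))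
  let A : ℕ → Fin n → Set E := fun b i => if (b, i) ∈ s then t (b, i) else Set.univ
  have hA : ∀ b i, MeasurableSet (A b i) := fun b i => by
    simp only [A]; split_ifs; exacts [ht _, .univ]
  rw [Measure.map_apply hm (hC.prod (.pi s.countable_toSet fun i _ => ht i))]
  have e1 : (fun ω => (D ω, fun p : ℕ × Fin n => V p.1 p.2 ω)) ⁻¹'
      (C ×ˢ (s : Set (ℕ × Fin n)).pi t) =
      {ω | D ω ∈ C ∧ ∀ b < B, ∀ i, V b i ω ∈ A b i} := by
    ext ω
    simp only [Set.mem_preimage, Set.mem_prod, Set.mem_pi, Finset.mem_coe, Set.mem_ofPred_eq, A]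
    refine and_congr_right fun _ => ⟨fun h b _ i => ?_, fun h p hp => ?_⟩
    · split_ifs with h0
      exacts [h _ h0, trivial]
    · have := h p.1 (hB' p hp) p.2
      rwa [if_pos hp] at this
  rw [e1, hS B C A hC hA]
  have hmeas : Measurable fun d => ∏ p ∈ s, k p.2 d (t p) :=
    Finset.measurable_fun_prod _ fun p _ => (k p.2).measurable_coe (ht p)
  rw [setLIntegral_map hC hmeas hD]
  refine lintegral_congr_ae (ae_restrict_of_ae ?_)
  filter_upwards [ae_all_iff.2 hK] with ω hω
  simp_rw [hω]
  rw [← Finset.prod_product' (Finset.range B) Finset.univ fun b i => k i (D ω) (A b i)]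
  symm
  have hsub : s ⊆ Finset.range B ×ˢ Finset.univ := fun p hp =>
    Finset.mem_product.2 ⟨Finset.mem_range.2 (hB' p hp), Finset.mem_univ _⟩
  rw [← Finset.prod_subset hsub]
  · refine Finset.prod_congr rfl fun p hp => ?_
    simp only [A, Prod.mk.eta, if_pos hp]
  · intro p _ hp
    simp only [A, if_neg hp, measure_univ]

/-- Randomized samples drawn coordinatewise from the conditional law of the data given a
statistic form, together with the data, a conditionally i.i.d. sequence given the statistic. -/
lemma map_randomized (μ : Measure Ω) [IsProbabilityMeasure μ] (δ : Measure 𝒟)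
    [IsProbabilityMeasure δ] {D : Fin n → Ω → 𝒟} (hD : ∀ i, Measurable (D i))
    (hind : iIndepFun D μ) (hδ : ∀ i, μ.map (D i) = δ) {σ : 𝒟 → 𝒮} (hσ : AEMeasurable σ δ)
    {ζ : 𝒟 → Z} (hζ : Measurable ζ) {V : ℕ → Fin n → Ω → E} (hV : ∀ b i, Measurable (V b i))
    {K : (Fin n → 𝒟) → Fin n → Measure E} (hS : IsCondSample μ (fun ω i => D i ω) V K)
    (k : Kernel 𝒮 E) [IsMarkovKernel k]
    (hK : ∀ i, ∀ᵐ ω ∂μ, K (fun j => D j ω) i = k (σ (D i ω)))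
    {φ : 𝒮 × E → Z} (hφ : Measurable φ) [IsMarkovKernel (pushKernel k φ)]
    (hpair : δ.map (fun d => (σ d, ζ d)) = δ.map σ ⊗ₘ pushKernel k φ) :
    AEMeasurable (fun ω i => σ (D i ω)) μ ∧
    AEMeasurable (fun ω b i => φ (σ (D i ω), V b i ω)) μ ∧
    μ.map (fun ω => ((fun i => σ (D i ω)), (fun i => ζ (D i ω)),
        fun b i => φ (σ (D i ω), V b i ω))) =
      μ.map (fun ω i => σ (D i ω)) ⊗ₘ
        ((infPi fun i : Fin n => (pushKernel k φ).comap (fun s : Fin n → 𝒮 => s i)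
            (measurable_pi_apply i)) ×ₖ
          infPi fun _ : ℕ => infPi fun i : Fin n => (pushKernel k φ).comap
            (fun s : Fin n → 𝒮 => s i) (measurable_pi_apply i)) := by
  set L := pushKernel k φ with hL
  set M := infPi fun i : Fin n => L.comap (fun s : Fin n → 𝒮 => s i) (measurable_pi_apply i)
    with hM
  let σ' := hσ.mk σ
  have hσ' : Measurable σ' := hσ.measurable_mk
  have hσe : ∀ᵐ ω ∂μ, ∀ i, σ (D i ω) = σ' (D i ω) := by
    rw [ae_all_iff]
    intro i
    exact ae_of_ae_map (p := fun d => σ d = σ' d) (hD i).aemeasurable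
      (by rw [hδ i]; exact hσ.ae_eq_mk)
  have hD' : Measurable fun ω i => D i ω := measurable_pi_lambda _ hD
  let S' : (Fin n → 𝒟) → Fin n → 𝒮 := fun d i => σ' (d i)
  have hS' : Measurable S' :=
    measurable_pi_lambda _ fun i => hσ'.comp (measurable_pi_apply i)
  have hz' : Measurable fun (d : Fin n → 𝒟) i => ζ (d i) :=
    measurable_pi_lambda _ fun i => hζ.comp (measurable_pi_apply i)
  have hSm : Measurable fun ω i => σ' (D i ω) := hS'.comp hD'
  have hzrm : Measurable fun ω b i => φ (σ' (D i ω), V b i ω) :=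
    measurable_pi_lambda _ fun b => measurable_pi_lambda _ fun i =>
      hφ.comp ((hσ'.comp (hD i)).prodMk (hV b i))
  have hSe : (fun ω i => σ (D i ω)) =ᵐ[μ] fun ω i => σ' (D i ω) := by
    filter_upwards [hσe] with ω hω
    funext i
    exact hω i
  have hzre : (fun ω b i => φ (σ (D i ω), V b i ω)) =ᵐ[μ]
      fun ω b i => φ (σ' (D i ω), V b i ω) := by
    filter_upwards [hσe] with ω hω
    funext b i
    rw [hω i]
  refine ⟨⟨_, hSm, hSe⟩, ⟨_, hzrm, hzre⟩, ?_⟩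
  have hν : μ.map (fun ω i => D i ω) = Measure.pi fun _ => δ := by
    rw [hind.map_fun_eq_pi_map fun i => (hD i).aemeasurable]
    simp_rw [hδ]
  have hDV := map_condSample μ hD' hV hS
    (fun i => k.comap (fun d : Fin n → 𝒟 => σ' (d i)) (hσ'.comp (measurable_pi_apply i)))
    (fun i => by
      filter_upwards [hK i, hσe] with ω h1 h2
      rw [h1, h2 i]; rfl)
  let Ψ : (Fin n → 𝒟) × (ℕ × Fin n → E) → ℕ → Fin n → Z := fun p b i =>
    φ (σ' (p.1 i), p.2 (b, i))
  have hΨ : Measurable Ψ := measurable_pi_lambda _ fun b => measurable_pi_lambda _ fun i =>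
    hφ.comp ((hσ'.comp ((measurable_pi_apply i).comp measurable_fst)).prodMk
      ((measurable_pi_apply (b, i)).comp measurable_snd))
  -- With the data fixed, mapping by `φ` coordinatewise and currying `ℕ × Fin n` turns the
  -- independent draws into an i.i.d. sequence of `n`-tuples, whose law involves the data only
  -- through `S'`.
  have hfib := map_compProd_of_fiber (μ.map fun ω i => D i ω)
    (infPi fun p : ℕ × Fin n =>
      k.comap (fun d : Fin n → 𝒟 => σ' (d p.2)) (hσ'.comp (measurable_pi_apply p.2)))
    ((infPi fun _ : ℕ => M).comap S' hS') hΨ (ae_of_all _ fun d => by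
      have hg : ∀ p : ℕ × Fin n, Measurable fun e => φ (σ' (d p.2), e) := fun p =>
        hφ.comp measurable_prodMk_left
      have h1 := Measure.infinitePi_map_pi (fun p : ℕ × Fin n => k (σ' (d p.2))) hg
      have h2 := Measure.infinitePi_map_curry (fun (_ : ℕ) (i : Fin n) => L (σ' (d i)))
      simp_rw [← pushKernel_apply k hφ] at h1
      rw [← hL] at h1
      have hgm : Measurable fun (v : ℕ × Fin n → E) p => φ (σ' (d p.2), v p) :=
        measurable_pi_lambda _ fun p => (hg p).comp (measurable_pi_apply p)
      rw [← h1, Measure.map_map (MeasurableEquiv.measurable _) hgm] at h2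
      exact h2)
  -- The `n`-fold product of `hpair`: the observed sample has the same conditional law `M` as each
  -- randomization.
  have hbase : (μ.map fun ω i => D i ω).map (fun d => (S' d, fun i => ζ (d i))) =
      (μ.map fun ω i => D i ω).map S' ⊗ₘ M := by
    have hpair' : δ.map (fun d => (σ' d, ζ d)) = δ.map σ' ⊗ₘ L := by
      rw [← Measure.map_congr hσ.ae_eq_mk, ← hpair]
      refine Measure.map_congr ?_
      filter_upwards [hσ.ae_eq_mk] with d hd
      rw [hd]
    have hβ : IsProbabilityMeasure (δ.map σ') :=
      Measure.isProbabilityMeasure_map hσ'.aemeasurable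
    have hσζ : Measurable fun (d : Fin n → 𝒟) i => (σ' (d i), ζ (d i)) :=
      measurable_pi_lambda _ fun i => (hσ'.prodMk hζ).comp (measurable_pi_apply i)
    have hsp : Measurable fun p : Fin n → 𝒮 × Z => (fun i => (p i).1, fun i => (p i).2) := by
      fun_prop
    have h1 := pi_compProd (ι := Fin n) (δ.map σ') L
    rw [← hM, ← hpair', ← Measure.pi_map_pi (fun _ => (hσ'.prodMk hζ).aemeasurable),
      ← Measure.pi_map_pi (fun _ => hσ'.aemeasurable),
      Measure.map_map hsp hσζ] at h1
    rw [hν]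
    exact h1
  have hfin := map_compProd_comap (μ.map fun ω i => D i ω) hS' hz' M (infPi fun _ : ℕ => M) hbase
  have hm1 : Measurable fun p : (Fin n → 𝒟) × (ℕ → Fin n → Z) =>
      (S' p.1, (fun i => ζ (p.1 i)), p.2) :=
    (hS'.comp measurable_fst).prodMk ((hz'.comp measurable_fst).prodMk measurable_snd)
  have hm2 : Measurable fun ω => ((fun i => D i ω), fun p : ℕ × Fin n => V p.1 p.2 ω) :=
    hD'.prodMk (measurable_pi_lambda _ fun p => hV p.1 p.2)
  rw [← hfib, ← hDV, Measure.map_map hm1 (measurable_fst.prodMk hΨ),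
    Measure.map_map (hm1.comp (measurable_fst.prodMk hΨ)) hm2, Measure.map_map hS' hD'] at hfin
  rw [Measure.map_congr hSe]
  refine Eq.trans (Measure.map_congr ?_) hfin
  filter_upwards [hSe, hzre] with ω h1 h2
  exact Prod.ext h1 (Prod.ext rfl h2)

end Sampling

/-! ### Markov versions and rearranged disintegrations. -/

section Reassociation

/-- A measurable version of `f` may fail to have mass one on a null set; a Dirac mass is substituted
there. -/
lemma exists_markovKernel_ae_eq {A B : Type*} [MeasurableSpace A] [MeasurableSpace B]
    [Nonempty B] {ν : Measure A} {f : A → Measure B} (hf : AEMeasurable f ν)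
    (hp : ∀ a, IsProbabilityMeasure (f a)) :
    ∃ k : Kernel A B, IsMarkovKernel k ∧ ∀ᵐ a ∂ν, f a = k a := by
  classical
  have hs : MeasurableSet {a | hf.mk f a Set.univ = 1} :=
    (Measure.measurable_coe .univ).comp hf.measurable_mk (measurableSet_singleton 1)
  let k0 : Kernel A B := ⟨hf.mk f, hf.measurable_mk⟩
  let k := Kernel.piecewise hs k0 (Kernel.const A (Measure.dirac (Classical.arbitrary B)))
  refine ⟨k, ⟨fun a => ?_⟩, ?_⟩
  · by_cases ha : a ∈ {a | hf.mk f a Set.univ = 1}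
    · simp only [k, Kernel.piecewise_apply, if_pos ha]
      exact ⟨ha⟩
    · simp only [k, Kernel.piecewise_apply, if_neg ha, Kernel.const_apply]
      infer_instance
  · filter_upwards [hf.ae_eq_mk] with a ha
    have : a ∈ {a | hf.mk f a Set.univ = 1} := by
      change hf.mk f a Set.univ = 1
      rw [← ha]
      exact (hp a).measure_univ
    simp only [k, Kernel.piecewise_apply, if_pos this]
    exact ha

variable {A B C : Type*} [MeasurableSpace A] [MeasurableSpace B] [MeasurableSpace C]

lemma map_fst_compProd (ν : Measure A) [SFinite ν] (k : Kernel A B) [IsMarkovKernel k] :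
    (ν ⊗ₘ k).map Prod.fst = ν :=
  Measure.fst_compProd ν k

lemma map_assoc_compProd_prod (β : Measure A) [IsProbabilityMeasure β] (k : Kernel A B)
    [IsMarkovKernel k] (l : Kernel A C) [IsMarkovKernel l] :
    (β ⊗ₘ (k ×ₖ l)).map (fun p => ((p.1, p.2.1), p.2.2)) =
      (β ⊗ₘ k) ⊗ₘ l.comap Prod.fst measurable_fst := by
  ext F hF
  have hm : Measurable fun p : A × B × C => ((p.1, p.2.1), p.2.2) := by fun_prop
  rw [Measure.map_apply hm hF, Measure.compProd_apply (hm hF), Measure.compProd_apply hF,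
    Measure.lintegral_compProd (Kernel.measurable_kernel_prodMk_left hF)]
  refine lintegral_congr fun a => ?_
  rw [Kernel.prod_apply, Measure.prod_apply (measurable_prodMk_left (hm hF))]
  rfl

lemma map_swap_compProd_prod (β : Measure A) [SFinite β] (k : Kernel A B)
    [IsMarkovKernel k] (l : Kernel A C) [IsMarkovKernel l] :
    (β ⊗ₘ (k ×ₖ l)).map (fun p => (p.1, p.2.2, p.2.1)) = β ⊗ₘ (l ×ₖ k) := by
  refine map_compProd_of_fiber β _ _ (Ψ := fun p : A × B × C => (p.2.2, p.2.1))
    (by fun_prop)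
    (ae_of_all _ fun a => ?_)
  rw [Kernel.prod_apply, Kernel.prod_apply]
  exact Measure.prod_swap

/-- If an observation can be rebuilt from its statistic and a component `e`, redrawing `e` from its
conditional law reproduces the conditional law of the observation. -/
lemma map_pushKernel {D S E Z : Type*} [MeasurableSpace D] [MeasurableSpace S] [MeasurableSpace E]
    [MeasurableSpace Z] (δ : Measure D) [IsProbabilityMeasure δ] {σ : D → S} {e : D → E}
    (hσ : AEMeasurable σ δ) (he : AEMeasurable e δ) (k : Kernel S E) [IsMarkovKernel k]
    {β : Measure S} [SFinite β] (h : δ.map (fun d => (σ d, e d)) = β ⊗ₘ k) {φ : S × E → Z} (hφ : Measurable φ)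
    {ζ : D → Z} (hζ : ∀ᵐ d ∂δ, ζ d = φ (σ d, e d)) :
    δ.map (fun d => (σ d, ζ d)) = δ.map σ ⊗ₘ pushKernel k φ := by
  have := isMarkovKernel_pushKernel k hφ
  have := Measure.isProbabilityMeasure_map hσ
  have hβ : δ.map σ = β := by
    rw [← map_fst_compProd β k, ← h,
      AEMeasurable.map_map_of_aemeasurable measurable_fst.aemeasurable (hσ.prodMk he)]
    rfl
  rw [← hβ] at h
  rw [← map_compProd_of_fiber (δ.map σ) k (pushKernel k φ) hφ
    (ae_of_all _ fun a => (pushKernel_apply k hφ a).symm), ← h,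
    AEMeasurable.map_map_of_aemeasurable (measurable_fst.prodMk hφ).aemeasurable (hσ.prodMk he)]
  refine Measure.map_congr ?_
  filter_upwards [hζ] with d hd
  rw [hd]
  rfl

lemma ae_of_ae_map_comp {Ω A B : Type*} [MeasurableSpace Ω] [MeasurableSpace A]
    [MeasurableSpace B] {μ : Measure Ω} {ν : Measure A} {D : Ω → A} (hD : Measurable D)
    (hDν : μ.map D = ν) {ρ : A → B} (hρ : AEMeasurable ρ ν) {p : B → Prop}
    (hp : ∀ᵐ r ∂(ν.map ρ), p r) :
    ∀ᵐ ω ∂μ, p (ρ (D ω)) := by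
  have h1 := ae_of_ae_map hρ hp
  rw [← hDν] at h1
  exact ae_of_ae_map hD.aemeasurable h1

end Reassociation

/-! ### One observation: conditional independence given the orbit. -/

section SingleSample

variable {G : Type*} [Group G] [MeasurableSpace G]
  {X : Type*} [MeasurableSpace X] [MulAction G X]
  {Y : Type*} [MeasurableSpace Y]
  {PX : Measure X} [IsProbabilityMeasure PX] {κ : Kernel X Y} [IsMarkovKernel κ] {ρ : X → X}

lemma jointLaw_eq_compProd (Q : InversionKernel G PX ρ) (Q' : Kernel X G) [IsMarkovKernel Q']
    (hQ : ∀ᵐ x ∂PX, Q.toFun x = Q' x) : jointLaw κ Q = PX ⊗ₘ (κ ×ₖ Q') := by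
  have he : (fun x => (Measure.dirac x).prod ((κ x).prod (Q.toFun x))) =ᵐ[PX]
      (Kernel.id ×ₖ (κ ×ₖ Q')) := by
    filter_upwards [hQ] with x hx
    rw [Kernel.prod_apply, Kernel.prod_apply, Kernel.id_apply, hx]
  rw [jointLaw, Measure.compProd_eq_comp_prod, Measure.bind, Measure.bind, Measure.map_congr he]

lemma inverts_jointLaw (Q : InversionKernel G PX ρ) (Q' : Kernel X G) [IsMarkovKernel Q']
    (hQ : ∀ᵐ x ∂PX, Q.toFun x = Q' x) {p : X → G → Prop}
    (hp : MeasurableSet {q : X × G | p q.1 q.2})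
    (h : ∀ᵐ x ∂PX, ∀ᵐ t ∂(Q' x), p x t) : ∀ᵐ w ∂(jointLaw κ Q), p w.1 w.2.2 := by
  rw [jointLaw_eq_compProd Q Q' hQ]
  refine Measure.ae_compProd_of_ae_ae
    ((show Measurable fun w : X × Y × G => (w.1, w.2.2) by fun_prop) hp) ?_
  filter_upwards [h] with x hx
  rw [Kernel.prod_apply]
  exact Measure.quasiMeasurePreserving_snd.ae hx

lemma map_fst_snd_jointLaw (Q : InversionKernel G PX ρ) (Q' : Kernel X G) [IsMarkovKernel Q']
    (hQ : ∀ᵐ x ∂PX, Q.toFun x = Q' x) :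
    (jointLaw κ Q).map (fun w => (w.1, w.2.1)) = PX ⊗ₘ κ := by
  rw [jointLaw_eq_compProd Q Q' hQ]
  refine map_compProd_of_fiber PX _ κ (Ψ := fun p : X × Y × G => p.2.1) (by fun_prop)
    (ae_of_all _ fun x => ?_)
  rw [Kernel.prod_apply]
  exact Measure.fst_prod

lemma map_fst_jointLaw (Q : InversionKernel G PX ρ) (Q' : Kernel X G) [IsMarkovKernel Q']
    (hQ : ∀ᵐ x ∂PX, Q.toFun x = Q' x) : (jointLaw κ Q).map Prod.fst = PX := by
  rw [jointLaw_eq_compProd Q Q' hQ, map_fst_compProd]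

/-- Averaging `P_{X|ρ}` over the law of `ρ X` returns `PX`, so a `PX`-null set is null for almost
every `P_{X|ρ}(· | r)`, and the mixtures of `Q` and `Q'` agree. -/
lemma groupOrbitKernel_ae_eq [StandardBorelSpace X] [Nonempty X] (Q : InversionKernel G PX ρ) (Q' : Kernel X G) [IsMarkovKernel Q']
    (hQ : ∀ᵐ x ∂PX, Q.toFun x = Q' x) (hρ : AEMeasurable ρ PX) :
    ∀ᵐ r ∂(PX.map ρ), groupOrbitKernel Q r = (Q' ∘ₖ condDistrib id ρ PX) r := by
  have hsnd : (PX.map ρ ⊗ₘ condDistrib id ρ PX).map Prod.snd = PX := by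
    rw [compProd_map_condDistrib aemeasurable_id,
      AEMeasurable.map_map_of_aemeasurable measurable_snd.aemeasurable
        (hρ.prodMk aemeasurable_id)]
    exact Measure.map_id
  have h1 : ∀ᵐ p ∂(PX.map ρ ⊗ₘ condDistrib id ρ PX), Q.toFun p.2 = Q' p.2 :=
    ae_of_ae_map (p := fun x => Q.toFun x = Q' x) measurable_snd.aemeasurable
      (by rw [hsnd]; exact hQ)
  have := Measure.isProbabilityMeasure_map hρ
  filter_upwards [Measure.ae_ae_of_ae_compProd h1] with r hr
  rw [groupOrbitKernel, Kernel.comp_apply, Measure.bind, Measure.bind, Measure.map_congr hr]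

lemma ae_smul_selector [StandardBorelSpace X] [MeasurableSMul₂ G X] (hρ : AEMeasurable ρ PX) (Q : InversionKernel G PX ρ) (Q' : Kernel X G)
    [IsMarkovKernel Q'] (hQ : ∀ᵐ x ∂PX, Q.toFun x = Q' x) :
    ∀ᵐ w ∂(jointLaw κ Q), w.2.2 • ρ w.1 = w.1 := by
  have h1 : ∀ᵐ w ∂(jointLaw κ Q), w.2.2 • hρ.mk ρ w.1 = w.1 := by
    have hm : Measurable fun q : X × G => q.2 • hρ.mk ρ q.1 :=
      measurable_snd.smul (hρ.measurable_mk.comp measurable_fst)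
    refine inverts_jointLaw Q Q' hQ (p := fun x t => t • hρ.mk ρ x = x)
      (measurableSet_eq_fun hm measurable_fst) ?_
    filter_upwards [hQ, hρ.ae_eq_mk] with x hx hρx
    rw [← hx, ← hρx]
    exact Q.inverts x
  have h2 : ∀ᵐ w ∂(jointLaw κ Q), ρ w.1 = hρ.mk ρ w.1 :=
    ae_of_ae_map (p := fun x => ρ x = hρ.mk ρ x) measurable_fst.aemeasurable
      (by rw [map_fst_jointLaw Q Q' hQ]; exact hρ.ae_eq_mk)
  filter_upwards [h1, h2] with w hw1 hw2
  rw [hw2, hw1]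

variable [MulAction G Y] [MeasurableInv G] [MeasurableSMul₂ G Y]

/-- Given `X` and `t`, the centered response `t⁻¹ • Y` has law `κ (ρ X)`. -/
lemma map_centered_jointLaw (hκ : EquivariantKernel G κ) (Q : InversionKernel G PX ρ)
    (Q' : Kernel X G) [IsMarkovKernel Q'] (hQ : ∀ᵐ x ∂PX, Q.toFun x = Q' x) {ρ' : X → X}
    (hρ' : Measurable ρ') (hρρ' : ρ =ᵐ[PX] ρ') :
    (jointLaw κ Q).map (fun w => (w.1, w.2.2⁻¹ • w.2.1, w.2.2)) =
      PX ⊗ₘ (κ.comap ρ' hρ' ×ₖ Q') := by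
  rw [jointLaw_eq_compProd Q Q' hQ]
  refine map_compProd_of_fiber PX _ _ 
    (Ψ := fun p : X × Y × G => (p.2.2⁻¹ • p.2.1, p.2.2)) (by fun_prop) ?_
  filter_upwards [hQ, hρρ'] with x h1 h2
  have hinv := Q.inverts x
  rw [h1] at hinv
  rw [Kernel.prod_apply, Kernel.prod_apply, Kernel.comap_apply, ← h2]
  have hm : Measurable fun b : Y × G => (b.2⁻¹ • b.1, b.2) := by fun_prop
  ext F hF
  rw [Measure.map_apply hm hF, Measure.prod_apply_symm (hm hF), Measure.prod_apply_symm hF]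
  refine lintegral_congr_ae ?_
  filter_upwards [hinv] with t ht
  have hFt : MeasurableSet ((fun y => (y, t)) ⁻¹' F) := measurable_prodMk_right hF
  -- Equivariance at the representative: `κ (ρ x) B = κ (t • ρ x) (t • B) = κ x (t • B)`.
  rw [hκ t (ρ x) _ hFt, ht, ← Set.preimage_smul_inv]
  rfl

/-- The centered response and the inversion variable are conditionally independent given `ρ X`. -/
lemma map_selector_jointLaw [StandardBorelSpace X] [Nonempty X] (hκ : EquivariantKernel G κ)
    (Q : InversionKernel G PX ρ) (Q' : Kernel X G) [IsMarkovKernel Q']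
    (hQ : ∀ᵐ x ∂PX, Q.toFun x = Q' x) (hρ : AEMeasurable ρ PX) :
    (jointLaw κ Q).map (fun w => (ρ w.1, w.2.2⁻¹ • w.2.1, w.2.2)) =
      PX.map ρ ⊗ₘ (κ ×ₖ (Q' ∘ₖ condDistrib id ρ PX)) := by
  set ρ' := hρ.mk ρ
  have hρ' : Measurable ρ' := hρ.measurable_mk
  have hρρ' : ρ =ᵐ[PX] ρ' := hρ.ae_eq_mk
  have hcd : PX.map (fun x => (ρ' x, x)) = PX.map ρ ⊗ₘ condDistrib id ρ PX := by
    rw [compProd_map_condDistrib aemeasurable_id]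
    refine Measure.map_congr ?_
    filter_upwards [hρρ'] with x hx
    rw [hx]; rfl
  have hfst := map_fst_jointLaw (κ := κ) Q Q' hQ
  have hρw : (fun w : X × Y × G => ρ w.1) =ᵐ[jointLaw κ Q] fun w => ρ' w.1 :=
    ae_of_ae_map (p := fun x => ρ x = ρ' x) measurable_fst.aemeasurable (by rw [hfst]; exact hρρ')
  have hmc : Measurable fun w : X × Y × G => (w.1, w.2.2⁻¹ • w.2.1, w.2.2) := by fun_prop
  have hm1 : Measurable fun w : X × Y × G => (ρ' w.1, w.2) := by fun_prop
  have e1 : (jointLaw κ Q).map (fun w => (ρ w.1, w.2.2⁻¹ • w.2.1, w.2.2)) =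
      (PX ⊗ₘ (κ.comap ρ' hρ' ×ₖ Q')).map fun w => (ρ' w.1, w.2) := by
    rw [← map_centered_jointLaw hκ Q Q' hQ hρ' hρρ', Measure.map_map hm1 hmc]
    refine Measure.map_congr ?_
    filter_upwards [hρw] with w hw
    rw [hw]; rfl
  have := Measure.isProbabilityMeasure_map hρ
  have := Measure.isProbabilityMeasure_map (μ := PX ⊗ₘ (κ.comap ρ' hρ' ×ₖ Q')) hm1.aemeasurable
  rw [e1]
  refine Measure.ext_prod₃ fun {C A B} hC hA hB => ?_
  rw [Measure.map_apply hm1 (hC.prod (hA.prod hB)),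
    show (fun w : X × Y × G => (ρ' w.1, w.2)) ⁻¹' (C ×ˢ A ×ˢ B) = (ρ' ⁻¹' C) ×ˢ (A ×ˢ B) from rfl,
    Measure.compProd_apply_prod (hρ' hC) (hA.prod hB),
    Measure.compProd_apply_prod hC (hA.prod hB)]
  -- The first factor sees `x` only through `r = ρ' x`, so it leaves the integral over `P_{X|ρ}(· |
  -- r)`; what remains is the mixture of `Q'`.
  have hg : Measurable fun q : X × X => κ q.1 A * Q' q.2 B :=
    ((κ.measurable_coe hA).comp measurable_fst).mul ((Q'.measurable_coe hB).comp measurable_snd)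
  have e2 := setLIntegral_map (μ := PX) (hC.prod (MeasurableSet.univ (α := X))) hg
    (hρ'.prodMk measurable_id)
  simp only [id] at e2
  rw [hcd, Measure.setLIntegral_compProd hg hC .univ] at e2
  simp only [Kernel.prod_apply, Measure.prod_prod, Kernel.comap_apply]
  have e3 : (fun x => (ρ' x, x)) ⁻¹' (C ×ˢ Set.univ) = ρ' ⁻¹' C := by ext; simp
  rw [e3] at e2
  rw [← e2]
  refine lintegral_congr fun r => ?_
  rw [Measure.restrict_univ]
  change ∫⁻ x, κ r A * Q' x B ∂(condDistrib id ρ PX r) = _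
  rw [lintegral_const_mul _ (Q'.measurable_coe hB),
    Kernel.comp_apply' _ _ _ hB]

variable [StandardBorelSpace X] [Nonempty X] [StandardBorelSpace Y] [Nonempty Y]

/-- Forgetting `t` in `map_selector_jointLaw` leaves a disintegration of the centered response over
`ρ X` with kernel `κ`; disintegrations are almost surely unique. -/
lemma centeredKernel_ae_eq (hκ : EquivariantKernel G κ) (Q : InversionKernel G PX ρ)
    (hρ : AEMeasurable ρ PX) : ∀ᵐ r ∂(PX.map ρ), centeredKernel κ Q r = κ r := by
  obtain ⟨Q', _, hQ⟩ := exists_markovKernel_ae_eq Q.aemeasurable Q.isProbabilityMeasure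
  have hfst := map_fst_jointLaw (κ := κ) Q Q' hQ
  have hρw : AEMeasurable (fun w : X × Y × G => ρ w.1) (jointLaw κ Q) :=
    AEMeasurable.comp_measurable (by rwa [hfst]) measurable_fst
  have hY : Measurable fun w : X × Y × G => w.2.2⁻¹ • w.2.1 := by fun_prop
  have h0 : (jointLaw κ Q).map (fun w => ρ w.1) = PX.map ρ := by
    conv_rhs => rw [← hfst]
    rw [AEMeasurable.map_map_of_aemeasurable (by rwa [hfst]) measurable_fst.aemeasurable]
    rfl
  have := Measure.isProbabilityMeasure_map hρ
  rw [← h0]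
  refine condDistrib_ae_eq_of_measure_eq_compProd _ hY.aemeasurable ?_
  have hC := congrArg (Measure.map fun p : X × Y × G => (p.1, p.2.1))
    (map_selector_jointLaw hκ Q Q' hQ hρ)
  rw [AEMeasurable.map_map_of_aemeasurable (by fun_prop)
    (hρw.prodMk (by fun_prop)), map_compProd_of_fiber (PX.map ρ) _ κ
    (Ψ := fun p : X × Y × G => p.2.1) (by fun_prop) (ae_of_all _ fun r => by
      rw [Kernel.prod_apply]; exact Measure.fst_prod)] at hC
  rw [h0]
  exact hC

end SingleSample

/-! ### The three randomization procedures. -/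

section Procedures

variable {G : Type*} [Group G] [MeasurableSpace G] [MeasurableInv G]
  {X : Type*} [MeasurableSpace X] [StandardBorelSpace X] [Nonempty X]
  [MulAction G X] [MeasurableSMul₂ G X]
  {Y : Type*} [MeasurableSpace Y] [StandardBorelSpace Y] [Nonempty Y]
  [MulAction G Y] [MeasurableSMul₂ G Y]
  {PX : Measure X} [IsProbabilityMeasure PX] {κ : Kernel X Y} [IsMarkovKernel κ]
  {ρ : X → X} {n : ℕ} {T : (Fin n → X × Y) → ℝ}
  {Ω : Type*} [MeasurableSpace Ω] {μ : Measure Ω} [IsProbabilityMeasure μ]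

/-- The randomization test is valid and consistent whenever every randomized coordinate is
`φ (s, e)`, where `s` is the statistic of the observed coordinate and `e ∼ k s`, and `φ (s, e)`
has the conditional law of the observed coordinate given the statistic. -/
lemma level_and_consistency_of_sampling {𝒟 𝒮 E : Type*} [MeasurableSpace 𝒟] [MeasurableSpace 𝒮]
    [MeasurableSpace E] (hT : Measurable T) (δ : Measure 𝒟) [IsProbabilityMeasure δ]
    {D : Fin n → Ω → 𝒟} (hD : ∀ i, Measurable (D i)) (hind : iIndepFun D μ)
    (hδ : ∀ i, μ.map (D i) = δ) {σ : 𝒟 → 𝒮} (hσ : AEMeasurable σ δ) {ζ : 𝒟 → X × Y} (hζ : Measurable ζ)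
    {V : ℕ → Fin n → Ω → E} (hV : ∀ b i, Measurable (V b i))
    {K : (Fin n → 𝒟) → Fin n → Measure E} (hS : IsCondSample μ (fun ω i => D i ω) V K)
    (k : Kernel 𝒮 E) [IsMarkovKernel k]
    (hK : ∀ i, ∀ᵐ ω ∂μ, K (fun j => D j ω) i = k (σ (D i ω)))
    {φ : 𝒮 × E → X × Y} (hφ : Measurable φ)
    (hpair : δ.map (fun d => (σ d, ζ d)) = δ.map σ ⊗ₘ pushKernel k φ)
    (hties : μ {ω | T (fun i => φ (σ (D i ω), V 0 i ω)) =
      T (fun i => φ (σ (D i ω), V 1 i ω))} = 0) :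
    HasConditionalLevel μ T (fun ω i => ζ (D i ω)) (fun ω b i => φ (σ (D i ω), V b i ω))
        (fun ω i => σ (D i ω)) ∧
      HasConditionalConsistency μ T (fun ω i => ζ (D i ω))
        (fun ω b i => φ (σ (D i ω), V b i ω)) (fun ω i => σ (D i ω)) := by
  have := isMarkovKernel_pushKernel k hφ
  obtain ⟨h1, h2, h3⟩ := map_randomized μ δ hD hind hδ hσ hζ hV hS k hK hφ hpair
  exact level_and_consistency μ hT
    (measurable_pi_lambda _ fun i => hζ.comp (hD i)).aemeasurable h2 h1 _ h3 hties

/-- By conditional independence, the law of `t` given both `ρ X` and `t⁻¹ • Y` is the group-orbit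
kernel at `ρ X` alone, which is exactly what is redrawn. -/
theorem randomizationR1 (hκ : EquivariantKernel G κ) (hρ : IsOrbitSelector G PX ρ)
    (Q : InversionKernel G PX ρ) (hT : Measurable T)
    {Xs : Fin n → Ω → X} (hXs : ∀ i, Measurable (Xs i))
    {Ys : Fin n → Ω → Y} (hYs : ∀ i, Measurable (Ys i))
    {Γ : ℕ → Fin n → Ω → G} (hΓ : ∀ b i, Measurable (Γ b i)) {Yt : ℕ → Fin n → Ω → Y}
    (hties : μ {ω | T (randomized ρ Xs Γ Yt ω 0) = T (randomized ρ Xs Γ Yt ω 1)} = 0)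
    {t : Fin n → Ω → G} (ht : ∀ i, Measurable (t i))
    (h : IsRandomizationR1 μ κ Q Xs Ys t Γ Yt) :
    HasConditionalLevel μ T (observed Xs Ys) (randomized ρ Xs Γ Yt)
        (fun ω i => (ρ (Xs i ω), (t i ω)⁻¹ • Ys i ω)) ∧
      HasConditionalConsistency μ T (observed Xs Ys) (randomized ρ Xs Γ Yt)
        (fun ω i => (ρ (Xs i ω), (t i ω)⁻¹ • Ys i ω)) := by
  obtain ⟨⟨hind, hlaw⟩, hY, hS⟩ := h
  obtain ⟨Q', _, hQ⟩ := exists_markovKernel_ae_eq Q.aemeasurable Q.isProbabilityMeasure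
  set GO := Q' ∘ₖ condDistrib id ρ PX
  have hδ : IsProbabilityMeasure (jointLaw κ Q) := by
    rw [jointLaw_eq_compProd Q Q' hQ]; infer_instance
  have := Measure.isProbabilityMeasure_map hρ.aemeasurable
  have hD : ∀ i, Measurable fun ω => (Xs i ω, Ys i ω, t i ω) := fun i =>
    (hXs i).prodMk ((hYs i).prodMk (ht i))
  have hX : ∀ i, μ.map (Xs i) = PX := fun i => by
    rw [← map_fst_jointLaw (κ := κ) Q Q' hQ, ← hlaw i, Measure.map_map measurable_fst (hD i)]
    rfl
  have hρw : AEMeasurable (fun w : X × Y × G => ρ w.1) (jointLaw κ Q) :=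
    AEMeasurable.comp_measurable
      (by rw [map_fst_jointLaw Q Q' hQ]; exact hρ.aemeasurable) measurable_fst
  have hYm : Measurable fun w : X × Y × G => w.2.2⁻¹ • w.2.1 := by fun_prop
  have hC := map_selector_jointLaw hκ Q Q' hQ hρ.aemeasurable
  have h3 := congrArg (Measure.map fun p : X × Y × G => ((p.1, p.2.1), p.2.2)) hC
  rw [map_assoc_compProd_prod, AEMeasurable.map_map_of_aemeasurable (by fun_prop)
    (hρw.prodMk (by fun_prop))] at h3
  have hrand : randomized ρ Xs Γ Yt = fun ω b i =>
      (Γ b i ω • ρ (Xs i ω), Γ b i ω • (t i ω)⁻¹ • Ys i ω) := by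
    funext ω b i
    simp only [randomized, hY]
  rw [hrand] at hties ⊢
  refine level_and_consistency_of_sampling hT (jointLaw κ Q) hD hind hlaw
    (σ := fun w => (ρ w.1, w.2.2⁻¹ • w.2.1)) (ζ := fun w => (w.1, w.2.1))
    (φ := fun p : (X × Y) × G => (p.2 • p.1.1, p.2 • p.1.2)) (hρw.prodMk hYm.aemeasurable)
    (by fun_prop) hΓ hS (GO.comap Prod.fst measurable_fst) ?_ (by fun_prop)
    (map_pushKernel (jointLaw κ Q) (e := fun w => w.2.2) (hρw.prodMk hYm.aemeasurable)
      (by fun_prop) _ h3 (by fun_prop) ?_) hties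
  · intro i
    exact ae_of_ae_map_comp (hXs i) (hX i) hρ.aemeasurable
      (groupOrbitKernel_ae_eq Q Q' hQ hρ.aemeasurable)
  · filter_upwards [ae_smul_selector hρ.aemeasurable Q Q' hQ] with w hw
    simp only [hw, smul_inv_smul]

/-- The mirror image of `randomizationR1`: `t` joins the statistic and the centered response is
redrawn, its law given `ρ X` and `t` being `κ (ρ X)`. -/
theorem randomizationR2 (hκ : EquivariantKernel G κ) (hρ : IsOrbitSelector G PX ρ)
    (Q : InversionKernel G PX ρ) (hT : Measurable T)
    {Xs : Fin n → Ω → X} (hXs : ∀ i, Measurable (Xs i))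
    {Ys : Fin n → Ω → Y} (hYs : ∀ i, Measurable (Ys i))
    {Γ : ℕ → Fin n → Ω → G} {Yt : ℕ → Fin n → Ω → Y} (hYt : ∀ b i, Measurable (Yt b i))
    (hties : μ {ω | T (randomized ρ Xs Γ Yt ω 0) = T (randomized ρ Xs Γ Yt ω 1)} = 0)
    {t : Fin n → Ω → G} (ht : ∀ i, Measurable (t i))
    (h : IsRandomizationR2 μ κ Q Xs Ys t Γ Yt) :
    HasConditionalLevel μ T (observed Xs Ys) (randomized ρ Xs Γ Yt)
        (fun ω i => (ρ (Xs i ω), t i ω)) ∧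
      HasConditionalConsistency μ T (observed Xs Ys) (randomized ρ Xs Γ Yt)
        (fun ω i => (ρ (Xs i ω), t i ω)) := by
  obtain ⟨⟨hind, hlaw⟩, hΓt, hS⟩ := h
  obtain ⟨Q', _, hQ⟩ := exists_markovKernel_ae_eq Q.aemeasurable Q.isProbabilityMeasure
  have hδ : IsProbabilityMeasure (jointLaw κ Q) := by
    rw [jointLaw_eq_compProd Q Q' hQ]; infer_instance
  have := Measure.isProbabilityMeasure_map hρ.aemeasurable
  have hD : ∀ i, Measurable fun ω => (Xs i ω, Ys i ω, t i ω) := fun i =>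
    (hXs i).prodMk ((hYs i).prodMk (ht i))
  have hX : ∀ i, μ.map (Xs i) = PX := fun i => by
    rw [← map_fst_jointLaw (κ := κ) Q Q' hQ, ← hlaw i, Measure.map_map measurable_fst (hD i)]
    rfl
  have hρw : AEMeasurable (fun w : X × Y × G => ρ w.1) (jointLaw κ Q) :=
    AEMeasurable.comp_measurable
      (by rw [map_fst_jointLaw Q Q' hQ]; exact hρ.aemeasurable) measurable_fst
  have hYm : Measurable fun w : X × Y × G => w.2.2⁻¹ • w.2.1 := by fun_prop
  have hC := map_selector_jointLaw hκ Q Q' hQ hρ.aemeasurable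
  have h2 := congrArg (Measure.map fun p : X × Y × G => (p.1, p.2.2, p.2.1)) hC
  rw [map_swap_compProd_prod, AEMeasurable.map_map_of_aemeasurable (by fun_prop)
    (hρw.prodMk (by fun_prop))] at h2
  simp only [Function.comp_def] at h2
  have h3 := congrArg (Measure.map fun p : X × G × Y => ((p.1, p.2.1), p.2.2)) h2
  rw [map_assoc_compProd_prod, AEMeasurable.map_map_of_aemeasurable (by fun_prop)
    (hρw.prodMk (measurable_snd.snd.prodMk hYm).aemeasurable)] at h3
  have hrand : randomized ρ Xs Γ Yt = fun ω b i =>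
      (t i ω • ρ (Xs i ω), t i ω • Yt b i ω) := by
    funext ω b i
    simp only [randomized, hΓt]
  rw [hrand] at hties ⊢
  refine level_and_consistency_of_sampling hT (jointLaw κ Q) hD hind hlaw
    (σ := fun w => (ρ w.1, w.2.2)) (ζ := fun w => (w.1, w.2.1))
    (φ := fun p : (X × G) × Y => (p.1.2 • p.1.1, p.1.2 • p.2)) (hρw.prodMk (by fun_prop))
    (by fun_prop) hYt hS (κ.comap Prod.fst measurable_fst) ?_ (by fun_prop)
    (map_pushKernel (jointLaw κ Q) (e := fun w => w.2.2⁻¹ • w.2.1) (hρw.prodMk (by fun_prop))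
      hYm.aemeasurable _ h3 (by fun_prop) ?_) hties
  · intro i
    exact ae_of_ae_map_comp (hXs i) (hX i) hρ.aemeasurable
      (centeredKernel_ae_eq hκ Q hρ.aemeasurable)
  · filter_upwards [ae_smul_selector hρ.aemeasurable Q Q' hQ] with w hw
    simp only [hw, smul_inv_smul]

theorem randomizationR3 (hκ : EquivariantKernel G κ) (hρ : IsOrbitSelector G PX ρ)
    (Q : InversionKernel G PX ρ) (hT : Measurable T)
    {Xs : Fin n → Ω → X} (hXs : ∀ i, Measurable (Xs i))
    {Ys : Fin n → Ω → Y} (hYs : ∀ i, Measurable (Ys i))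
    {Γ : ℕ → Fin n → Ω → G} (hΓ : ∀ b i, Measurable (Γ b i))
    {Yt : ℕ → Fin n → Ω → Y} (hYt : ∀ b i, Measurable (Yt b i))
    (hties : μ {ω | T (randomized ρ Xs Γ Yt ω 0) = T (randomized ρ Xs Γ Yt ω 1)} = 0)
    (h : IsRandomizationR3 μ κ Q Xs Ys Γ Yt) :
    HasConditionalLevel μ T (observed Xs Ys) (randomized ρ Xs Γ Yt)
        (fun ω i => ρ (Xs i ω)) ∧
      HasConditionalConsistency μ T (observed Xs Ys) (randomized ρ Xs Γ Yt)
        (fun ω i => ρ (Xs i ω)) := by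
  obtain ⟨⟨hind, hlaw⟩, hS⟩ := h
  obtain ⟨Q', _, hQ⟩ := exists_markovKernel_ae_eq Q.aemeasurable Q.isProbabilityMeasure
  set GO := Q' ∘ₖ condDistrib id ρ PX
  have hδ : IsProbabilityMeasure (jointLaw κ Q) := by
    rw [jointLaw_eq_compProd Q Q' hQ]; infer_instance
  have := Measure.isProbabilityMeasure_map hρ.aemeasurable
  have hD : ∀ i, Measurable fun ω => (Xs i ω, Ys i ω) := fun i => (hXs i).prodMk (hYs i)
  have hX : ∀ i, μ.map (Xs i) = PX := fun i => by
    conv_rhs => rw [← map_fst_compProd PX κ]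
    rw [← hlaw i, Measure.map_map measurable_fst (hD i)]
    rfl
  have hρw : AEMeasurable (fun w : X × Y × G => ρ w.1) (jointLaw κ Q) :=
    AEMeasurable.comp_measurable
      (by rw [map_fst_jointLaw Q Q' hQ]; exact hρ.aemeasurable) measurable_fst
  have hρd : AEMeasurable (fun d : X × Y => ρ d.1) (PX ⊗ₘ κ) :=
    AEMeasurable.comp_measurable
      (by rw [map_fst_compProd]; exact hρ.aemeasurable) measurable_fst
  have hYm : Measurable fun w : X × Y × G => w.2.2⁻¹ • w.2.1 := by fun_prop
  have hXY := map_fst_snd_jointLaw (κ := κ) Q Q' hQ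
  have hC := map_selector_jointLaw hκ Q Q' hQ hρ.aemeasurable
  have h2 := congrArg (Measure.map fun p : X × Y × G => (p.1, p.2.2, p.2.1)) hC
  rw [map_swap_compProd_prod, AEMeasurable.map_map_of_aemeasurable (by fun_prop)
    (hρw.prodMk (by fun_prop))] at h2
  simp only [Function.comp_def] at h2
  have hφ : Measurable fun p : X × G × Y => (p.2.1 • p.1, p.2.1 • p.2.2) := by fun_prop
  have h5 := map_pushKernel (jointLaw κ Q) (σ := fun w => ρ w.1)
    (e := fun w => (w.2.2, w.2.2⁻¹ • w.2.1)) (ζ := fun w => (w.1, w.2.1)) hρw (by fun_prop)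
    (GO ×ₖ κ) h2 hφ (by
      filter_upwards [ae_smul_selector hρ.aemeasurable Q Q' hQ] with w hw
      simp only [hw, smul_inv_smul])
  have hm12 : Measurable fun w : X × Y × G => (w.1, w.2.1) := by fun_prop
  -- The data carry no inversion variable here. The identity is proved under `jointLaw κ Q`, where
  -- `t` exists, and pushed to its `(X, Y)`-marginal `PX ⊗ₘ κ`.
  have hpair : (PX ⊗ₘ κ).map (fun d => (ρ d.1, d)) =
      (PX ⊗ₘ κ).map (fun d => ρ d.1) ⊗ₘ
        pushKernel (GO ×ₖ κ) fun p : X × G × Y => (p.2.1 • p.1, p.2.1 • p.2.2) := by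
    rw [← hXY] at hρd ⊢
    have hρd' := hρd.prodMk aemeasurable_id
    simp only [id] at hρd'
    rw [AEMeasurable.map_map_of_aemeasurable hρd' hm12.aemeasurable,
      AEMeasurable.map_map_of_aemeasurable hρd hm12.aemeasurable]
    exact h5
  refine level_and_consistency_of_sampling hT (PX ⊗ₘ κ) hD hind hlaw
    (σ := fun d => ρ d.1) (ζ := fun d => d)
    (φ := fun p : X × G × Y => (p.2.1 • p.1, p.2.1 • p.2.2)) hρd measurable_id
    (V := fun b i ω => (Γ b i ω, Yt b i ω)) (fun b i => (hΓ b i).prodMk (hYt b i)) hS (GO ×ₖ κ) (fun i => ?_) hφ hpair hties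
  refine ae_of_ae_map_comp (p := fun r =>
    (groupOrbitKernel Q r).prod (centeredKernel κ Q r) = (GO ×ₖ κ) r) (hXs i) (hX i)
    hρ.aemeasurable ?_
  filter_upwards [groupOrbitKernel_ae_eq Q Q' hQ hρ.aemeasurable,
    centeredKernel_ae_eq hκ Q hρ.aemeasurable] with r h1 h2
  rw [h1, h2, Kernel.prod_apply]

end Procedures

end CRT

theorem mainTheorem3
    {G : Type*} [Group G] [TopologicalSpace G] [IsTopologicalGroup G] [LocallyCompactSpace G]
    [SecondCountableTopology G] [T2Space G] [MeasurableSpace G] [BorelSpace G]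
    {X : Type*} [MeasurableSpace X] [StandardBorelSpace X] [Nonempty X]
    [MulAction G X] [MeasurableSMul₂ G X]
    {Y : Type*} [MeasurableSpace Y] [StandardBorelSpace Y] [Nonempty Y]
    [MulAction G Y] [MeasurableSMul₂ G Y]
    (PX : Measure X) [IsProbabilityMeasure PX] (κ : Kernel X Y) [IsMarkovKernel κ]
    (hκ : CRT.EquivariantKernel G κ)
    (ρ : X → X) (hρ : CRT.IsOrbitSelector G PX ρ) (Q : CRT.InversionKernel G PX ρ)
    (n : ℕ) (T : (Fin n → X × Y) → ℝ) (hT : Measurable T)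
    {Ω : Type*} [MeasurableSpace Ω] (μ : Measure Ω) [IsProbabilityMeasure μ]
    (Xs : Fin n → Ω → X) (hXs : ∀ i, Measurable (Xs i))
    (Ys : Fin n → Ω → Y) (hYs : ∀ i, Measurable (Ys i))
    (Γ : ℕ → Fin n → Ω → G) (hΓ : ∀ b i, Measurable (Γ b i))
    (Yt : ℕ → Fin n → Ω → Y) (hYt : ∀ b i, Measurable (Yt b i))
    (hties : ∀ b b' : ℕ, b ≠ b' →
      μ {ω | T (CRT.randomized ρ Xs Γ Yt ω b) = T (CRT.randomized ρ Xs Γ Yt ω b')} = 0) :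
    (∀ t : Fin n → Ω → G, (∀ i, Measurable (t i)) →
      CRT.IsRandomizationR1 μ κ Q Xs Ys t Γ Yt →
      CRT.HasConditionalLevel μ T (CRT.observed Xs Ys) (CRT.randomized ρ Xs Γ Yt)
        (fun ω i => (ρ (Xs i ω), (t i ω)⁻¹ • Ys i ω)) ∧
      CRT.HasConditionalConsistency μ T (CRT.observed Xs Ys) (CRT.randomized ρ Xs Γ Yt)
        (fun ω i => (ρ (Xs i ω), (t i ω)⁻¹ • Ys i ω))) ∧
    (∀ t : Fin n → Ω → G, (∀ i, Measurable (t i)) →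
      CRT.IsRandomizationR2 μ κ Q Xs Ys t Γ Yt →
      CRT.HasConditionalLevel μ T (CRT.observed Xs Ys) (CRT.randomized ρ Xs Γ Yt)
        (fun ω i => (ρ (Xs i ω), t i ω)) ∧
      CRT.HasConditionalConsistency μ T (CRT.observed Xs Ys) (CRT.randomized ρ Xs Γ Yt)
        (fun ω i => (ρ (Xs i ω), t i ω))) ∧
    (CRT.IsRandomizationR3 μ κ Q Xs Ys Γ Yt →
      CRT.HasConditionalLevel μ T (CRT.observed Xs Ys) (CRT.randomized ρ Xs Γ Yt)
        (fun ω i => ρ (Xs i ω)) ∧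
      CRT.HasConditionalConsistency μ T (CRT.observed Xs Ys) (CRT.randomized ρ Xs Γ Yt)
        (fun ω i => ρ (Xs i ω))) := by
  have h01 := hties 0 1 zero_ne_one
  exact ⟨fun t ht h => CRT.randomizationR1 hκ hρ Q hT hXs hYs hΓ h01 ht h,
    fun t ht h => CRT.randomizationR2 hκ hρ Q hT hXs hYs hYt h01 ht h,
    fun h => CRT.randomizationR3 hκ hρ Q hT hXs hYs hΓ hYt h01 h⟩
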